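/- Fix integers $k>1$, $T\ge 1$, $S\ge 1$, reals $\mu\in[1,k]$, $\delta\in(0,1)$, and a reward sequence $g_j(t)\in[0,1]$ ($j\in[k]$, $t\in[T]$) fixed in advance. Put $$\eta=\sqrt{\tfrac{S}{\mu T}},\qquad \alpha=\tfrac1T,\qquad \beta=2\eta\sqrt{6\log(3k/\delta)},\qquad \gamma=\eta^2(1+\beta)^2k^2 .$$ The decoupled bandit algorithm for switching starts from $w_j(1)=1$ for all $j\in[k]$. In each round $t=1,\dots,T$ it sets $$p_j(t)=(1-\gamma)\frac{w_j(t)}{\sum_{l=1}^k w_l(t)}+\frac{\gamma}{k},\qquad q_j(t)=\frac{\sqrt{p_j(t)}}{\sum_{l=1}^k\sqrt{p_l(t)}},$$ draws an action $i_t$ from $\mathbf p(t)$ and (independently given the past) a query $j_t$ from $\mathbf q(t)$, observes $g_{j_t}(t)$, and updates $$\tilde g_j(t)=\frac{1}{q_j(t)}\bigl(g_j(t)\mathbf 1_{j_t=j}+\beta\bigr),\qquad w_j(t+1)=w_j(t)\,e^{\eta\tilde g_j(t)}+\frac{e\alpha}{k}\sum_{i=1}^k w_i(t).$$ For $v\in[1,k]$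 let $$P(v,\delta,\mu)=\Pr\Bigl(\frac1T\sum_{t=1}^T\Bigl(\sum_{j=1}^k\sqrt{p_j(t)}\Bigr)^2>v\Bigr),$$ the probability being over the randomness of the algorithm. There are universal constants $C>0$ and $c\in\mathbb N$ such that the following holds for all $k,T,S,\mu,\delta,g$ as above with $(1+\beta)^2\le 2$ and $\gamma\le 1$ (so that $\mathbf p(t)$ is a probability vector), and all $v\in[1,k]$. With probability at least $1-\delta-P(v,\delta,\mu)$, simultaneously for all segmentations $0=T_1\le T_2\le\dots\le T_{S+1}=T$ of $\{1,\dots,T\}$ into $S$ epochs and all choices of actions $i^1,\dots,i^S\in[k]$, $$\sum_{s=1}^S\sum_{t=T_s+1}^{T_{s+1}}g_{i^s}(t)-\sum_{t=1}^Tg_{i_t}(t)\;\le\; C\,\bigl(1+\log\tfrac k\delta\bigr)^c\,(1+\log T)\left(\sqrt{S\Bigl(\frac{v^2}{\mu}+\mu+v\Bigr)T}+\frac{S k^2}{\mu}+\frac{k^2}{T^{3/2}}\right).$$ -/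

import Mathlib

open scoped BigOperators ENNReal

namespace SwitchingBandit

noncomputable section

/-- Step size `η = √(S / (μ T))`. -/
def eta (T S : ℕ) (μ : ℝ) : ℝ := √((S : ℝ) / (μ * T))

/-- Sharing rate `α = 1 / T`. -/
def alpha (T : ℕ) : ℝ := 1 / (T : ℝ)

/-- Bonus `β = 2 η √(6 log (3 k / δ))`. -/
def beta (k T S : ℕ) (μ δ : ℝ) : ℝ :=
  2 * eta T S μ * √(6 * Real.log (3 * k / δ))

/-- Uniform mixing rate `γ = η² (1 + β)² k²`. -/
def gamma (k T S : ℕ) (μ δ : ℝ) : ℝ :=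
  eta T S μ ^ 2 * (1 + beta k T S μ δ) ^ 2 * (k : ℝ) ^ 2

/-- `p_j = (1 - γ) w_j / ∑ l, w_l + γ / k`. -/
def mix {k : ℕ} (γ : ℝ) (w : Fin k → ℝ) (j : Fin k) : ℝ :=
  (1 - γ) * (w j / ∑ l, w l) + γ / k

/-- `q_j = √p_j / ∑ l, √p_l`. -/
def sqrtDist {k : ℕ} (p : Fin k → ℝ) (j : Fin k) : ℝ := √(p j) / ∑ l, √(p l)

/-- `‖p‖_{1/2} = (∑ j, √p_j)²`. -/
def halfNorm {k : ℕ} (p : Fin k → ℝ) : ℝ := (∑ j, √(p j)) ^ 2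

/-- Reward estimate `g̃_j = (x_j 1_{b = j} + β) / q_j`, where `x` is the reward vector of the round
and `b` the queried action. -/
def estimate {k : ℕ} (β : ℝ) (q x : Fin k → ℝ) (b j : Fin k) : ℝ :=
  1 / q j * (x j * (if b = j then 1 else 0) + β)

/-- The weights `w(n+1)` after `n` rounds with history `h`; `h s` is the pair
(chosen action, queried action) of round `s + 1`, and `g t` is the reward vector of round `t`. -/
def weight (k T S : ℕ) (μ δ : ℝ) (g : ℕ → Fin k → ℝ) :
    (n : ℕ) → (Fin n → Fin k × Fin k) → Fin k → ℝ
  | 0, _ => fun _ => 1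
  | n + 1, h => fun j =>
      let w : Fin k → ℝ := weight k T S μ δ g n (Fin.init h)
      let q : Fin k → ℝ := sqrtDist (mix (gamma k T S μ δ) w)
      w j * Real.exp (eta T S μ *
          estimate (beta k T S μ δ) q (g (n + 1)) (h (Fin.last n)).2 j)
        + Real.exp 1 * alpha T / k * ∑ i, w i

/-- The action distribution `p(n+1)` of round `n + 1`, given the history of the first `n` rounds. -/
def actionProb (k T S : ℕ) (μ δ : ℝ) (g : ℕ → Fin k → ℝ) (n : ℕ)
    (h : Fin n → Fin k × Fin k) : Fin k → ℝ :=
  mix (gamma k T S μ δ) (weight k T S μ δ g n h)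

/-- The query distribution `q(n+1)` of round `n + 1`, given the history of the first `n` rounds. -/
def queryProb (k T S : ℕ) (μ δ : ℝ) (g : ℕ → Fin k → ℝ) (n : ℕ)
    (h : Fin n → Fin k × Fin k) : Fin k → ℝ :=
  sqrtDist (actionProb k T S μ δ g n h)

theorem weight_pos {k T S : ℕ} {μ δ : ℝ} {g : ℕ → Fin k → ℝ} :
    ∀ (n : ℕ) (h : Fin n → Fin k × Fin k) (j : Fin k), 0 < weight k T S μ δ g n h j
  | 0, _, _ => one_pos
  | n + 1, h, j => by
      have ih := weight_pos (T := T) (S := S) (μ := μ) (δ := δ) (g := g) n (Fin.init h)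
      have hs : 0 ≤ ∑ i, weight k T S μ δ g n (Fin.init h) i :=
        Finset.sum_nonneg fun i _ => (ih i).le
      have ha : 0 ≤ Real.exp 1 * alpha T / k := by unfold alpha; positivity
      exact add_pos_of_pos_of_nonneg (mul_pos (ih j) (Real.exp_pos _)) (mul_nonneg ha hs)

theorem gamma_nonneg (k T S : ℕ) (μ δ : ℝ) : 0 ≤ gamma k T S μ δ := by
  unfold gamma; positivity

theorem actionProb_nonneg {k T S : ℕ} {μ δ : ℝ} {g : ℕ → Fin k → ℝ}
    (hγ : gamma k T S μ δ ≤ 1) (n : ℕ) (h : Fin n → Fin k × Fin k) (j : Fin k) :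
    0 ≤ actionProb k T S μ δ g n h j := by
  have hw := weight_pos (T := T) (S := S) (μ := μ) (δ := δ) (g := g) n h
  have hs : 0 ≤ ∑ i, weight k T S μ δ g n h i := Finset.sum_nonneg fun i _ => (hw i).le
  have h0 := gamma_nonneg k T S μ δ
  exact add_nonneg (mul_nonneg (by linarith) (div_nonneg (hw j).le hs)) (by positivity)

theorem sum_actionProb {k T S : ℕ} {μ δ : ℝ} {g : ℕ → Fin k → ℝ} (hk : 1 < k)
    (n : ℕ) (h : Fin n → Fin k × Fin k) : ∑ j, actionProb k T S μ δ g n h j = 1 := by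
  have hw := weight_pos (T := T) (S := S) (μ := μ) (δ := δ) (g := g) n h
  have hs : 0 < ∑ i, weight k T S μ δ g n h i :=
    Finset.sum_pos (fun i _ => hw i) ⟨⟨0, by omega⟩, Finset.mem_univ _⟩
  have hk' : (k : ℝ) ≠ 0 := by positivity
  simp only [actionProb, mix, Finset.sum_add_distrib, ← Finset.mul_sum, ← Finset.sum_div,
    Finset.sum_const, Finset.card_univ, Fintype.card_fin, nsmul_eq_mul]
  rw [div_self hs.ne']
  field_simp
  ring

theorem queryProb_nonneg {k T S : ℕ} {μ δ : ℝ} {g : ℕ → Fin k → ℝ} (n : ℕ)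
    (h : Fin n → Fin k × Fin k) (j : Fin k) : 0 ≤ queryProb k T S μ δ g n h j :=
  div_nonneg (Real.sqrt_nonneg _) (Finset.sum_nonneg fun _ _ => Real.sqrt_nonneg _)

theorem sum_queryProb {k T S : ℕ} {μ δ : ℝ} {g : ℕ → Fin k → ℝ} (hk : 1 < k)
    (n : ℕ) (h : Fin n → Fin k × Fin k) : ∑ j, queryProb k T S μ δ g n h j = 1 := by
  have hpos : ∃ j, 0 < actionProb k T S μ δ g n h j := by
    by_contra hcon
    have hle : ∀ j, actionProb k T S μ δ g n h j ≤ 0 := fun j =>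
      not_lt.mp fun hj => hcon ⟨j, hj⟩
    have h1 := Finset.sum_nonpos fun j (_ : j ∈ Finset.univ) => hle j
    rw [sum_actionProb hk] at h1
    linarith
  obtain ⟨j, hj⟩ := hpos
  have hs : 0 < ∑ l, √(actionProb k T S μ δ g n h l) :=
    Finset.sum_pos' (fun _ _ => Real.sqrt_nonneg _) ⟨j, Finset.mem_univ _, Real.sqrt_pos.mpr hj⟩
  simp only [queryProb, sqrtDist, ← Finset.sum_div]
  exact div_self hs.ne'

/-- The law `p(n+1)` of the action chosen in round `n + 1`. -/
def actionLaw {k T S : ℕ} {μ δ : ℝ} (hk : 1 < k) (hγ : gamma k T S μ δ ≤ 1)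
    (g : ℕ → Fin k → ℝ) (n : ℕ) (h : Fin n → Fin k × Fin k) : PMF (Fin k) :=
  PMF.ofFintype (fun j => ENNReal.ofReal (actionProb k T S μ δ g n h j)) (by
    rw [← ENNReal.ofReal_sum_of_nonneg fun j _ => actionProb_nonneg hγ n h j,
      sum_actionProb hk, ENNReal.ofReal_one])

/-- The law `q(n+1)` of the action queried in round `n + 1`. -/
def queryLaw {k : ℕ} (T S : ℕ) (μ δ : ℝ) (hk : 1 < k)
    (g : ℕ → Fin k → ℝ) (n : ℕ) (h : Fin n → Fin k × Fin k) : PMF (Fin k) :=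
  PMF.ofFintype (fun j => ENNReal.ofReal (queryProb k T S μ δ g n h j)) (by
    rw [← ENNReal.ofReal_sum_of_nonneg fun j _ => queryProb_nonneg n h j,
      sum_queryProb hk, ENNReal.ofReal_one])

/-- The law of the history of the first `n` rounds of the algorithm run on the fixed rewards `g`:
in each round the chosen and the queried action are drawn from `p` and `q` with fresh
randomness. -/
def law {k T S : ℕ} {μ δ : ℝ} (hk : 1 < k) (hγ : gamma k T S μ δ ≤ 1)
    (g : ℕ → Fin k → ℝ) : (n : ℕ) → PMF (Fin n → Fin k × Fin k)
  | 0 => PMF.pure Fin.elim0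
  | n + 1 =>
      (law hk hγ g n).bind fun h =>
        (actionLaw hk hγ g n h).bind fun i =>
          (queryLaw T S μ δ hk g n h).map fun j =>
            Fin.snoc (α := fun _ => Fin k × Fin k) h (i, j)

/-- `(1 / T) ∑_{t=1}^{T} ‖p(t)‖_{1/2}` along the run `ω`. -/
def avgHalfNorm (k T S : ℕ) (μ δ : ℝ) (g : ℕ → Fin k → ℝ) (ω : Fin T → Fin k × Fin k) : ℝ :=
  1 / (T : ℝ) * ∑ t : Fin T,
    halfNorm (actionProb k T S μ δ g t (Fin.take (t : ℕ) t.isLt.le ω))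

/-- `P(v, δ, μ)`, the probability that the average of `‖p(t)‖_{1/2}` exceeds `v`. -/
def excessProb {k T S : ℕ} {μ δ : ℝ} (hk : 1 < k) (hγ : gamma k T S μ δ ≤ 1)
    (g : ℕ → Fin k → ℝ) (v : ℝ) : ℝ :=
  (law hk hγ g T).toMeasure.real {ω | v < avgHalfNorm k T S μ δ g ω}

/-- Division points `0 = τ_0 ≤ τ_1 ≤ ... ≤ τ_S = T` of `{1, ..., T}`; the epochs are the sets
`{τ_s + 1, ..., τ_{s+1}}`. -/
def IsSegmentation (T S : ℕ) (τ : Fin (S + 1) → ℕ) : Prop :=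
  Monotone τ ∧ τ 0 = 0 ∧ τ (Fin.last S) = T

/-- Regret of the run `ω` against playing `a s` throughout epoch `s` of the segmentation `τ`. -/
def regret {k T S : ℕ} (g : ℕ → Fin k → ℝ) (τ : Fin (S + 1) → ℕ) (a : Fin S → Fin k)
    (ω : Fin T → Fin k × Fin k) : ℝ :=
  (∑ s : Fin S, ∑ t ∈ Finset.Ioc (τ s.castSucc) (τ s.succ), g t (a s))
    - ∑ t : Fin T, g ((t : ℕ) + 1) (ω t).1

end

end SwitchingBandit

/-! Let G and A be the rewards of the comparator and of the algorithm, X the comparator's gain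
measured by the estimates, Y the sum of p_b x_b / q_b over the queried actions b, and M the sum of
the conditional mean rewards. Then G - A = γG + (1-γ)(G-X) + ((1-γ)X - Y) + (Y-M) + (M-A), and each
summand is bounded separately.

The term (1-γ)X - Y is deterministic. Weight sharing keeps every action at a share of at least
1/(2kT), so each epoch can restart at the cost of log(2kT), and the growth of the log-potential
telescopes over epochs (`segmentation_gain_le`). Querying with q ∝ √p makes p_j / q_j² the same
number ‖p‖_{1/2} for all j (`div_sqrtDist_sq`), so the bonus and the second-order terms cost
O(β‖p‖_{1/2}) per round (`estimated_gain_le`).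

The random terms G-X, Y-M and M-A are controlled by path sums whose exponentials are
supermartingales (`law_pathSum_gt_le`). For G-X the union bound runs over single epochs and actions,
about kT² events, rather than over whole segmentations; one good event thus serves all comparators
at once. The three failure events have probability at most δ/3 each, and the event that the average
of ‖p(t)‖_{1/2} exceeds v accounts for P(v, δ, μ).

The choice of η gives S/η = √(SμT) and ηTv = √(S(v²/μ)T), while γT ≤ 2Sk²/μ
(`explicit_regret_terms_le`). -/

namespace SwitchingBandit

/-! ### Exponential moments and second moments within a single round. -/

section OneRound

/-- One-step Bernstein bound: e^z ≤ 1 + z + z² for |z| ≤ 1, the linear term averages to zero, and 1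
+ s ≤ e^s. -/
theorem sum_mul_exp_le_exp {ι : Type*} [Fintype ι] {p z : ι → ℝ} {s : ℝ} (hp : ∀ i, 0 ≤ p i)
    (hp1 : ∑ i, p i = 1) (hz : ∀ i, |z i| ≤ 1) (hz0 : ∑ i, p i * z i = 0)
    (hs : ∑ i, p i * z i ^ 2 ≤ s) : ∑ i, p i * Real.exp (z i) ≤ Real.exp s := by
  have h : ∑ i, p i * Real.exp (z i) ≤ ∑ i, (p i + p i * z i + p i * z i ^ 2) := by
    refine Finset.sum_le_sum fun i _ => ?_
    have h1 := (abs_le.mp (Real.abs_exp_sub_one_sub_id_le (hz i))).2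
    nlinarith [hp i]
  rw [Finset.sum_add_distrib, Finset.sum_add_distrib, hp1, hz0] at h
  linarith [Real.add_one_le_exp s]

/-- Follows from e^(-y)(1 + y) ≤ 1 ≤ 1 + y³ = (1 - y + y²)(1 + y). There is no upper limit on y, so
lower deviations of the estimates need no bound on their range. -/
theorem exp_neg_le_quadratic {y : ℝ} (hy : 0 ≤ y) : Real.exp (-y) ≤ 1 - y + y ^ 2 := by
  have h1 : y + 1 ≤ Real.exp y := Real.add_one_le_exp y
  have h2 : Real.exp (-y) * Real.exp y = 1 := by rw [← Real.exp_add]; simp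
  have h3 : Real.exp (-y) * (y + 1) ≤ 1 := by
    have := mul_le_mul_of_nonneg_left h1 (Real.exp_pos (-y)).le
    linarith
  have h4 : (Real.exp (-y)) * (y + 1) ≤ (1 - y + y ^ 2) * (y + 1) := by
    nlinarith [pow_nonneg hy 3]
  exact le_of_mul_le_mul_right h4 (by linarith)

variable {k : ℕ} {p x : Fin k → ℝ}

theorem sum_sqrt_pos (hp : ∀ j, 0 < p j) (j : Fin k) : 0 < ∑ l, √(p l) :=
  Finset.sum_pos (fun l _ => Real.sqrt_pos.mpr (hp l)) ⟨j, Finset.mem_univ _⟩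

theorem sqrtDist_pos (hp : ∀ j, 0 < p j) (j : Fin k) : 0 < sqrtDist p j :=
  div_pos (Real.sqrt_pos.mpr (hp j)) (sum_sqrt_pos hp j)

theorem sum_sqrtDist (hp : ∀ j, 0 < p j) (hk : 0 < k) : ∑ j, sqrtDist p j = 1 := by
  simp only [sqrtDist, ← Finset.sum_div]
  exact div_self (sum_sqrt_pos hp ⟨0, hk⟩).ne'

theorem div_sqrtDist (hp : ∀ j, 0 < p j) (j : Fin k) :
    p j / sqrtDist p j = √(p j) * ∑ l, √(p l) := by
  have h1 := sum_sqrt_pos hp j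
  have h2 := Real.sqrt_pos.mpr (hp j)
  rw [sqrtDist, div_div_eq_mul_div, div_eq_iff h2.ne']
  nth_rewrite 1 [← Real.mul_self_sqrt (hp j).le]
  ring

/-- The reason for querying with √p: p_j cancels and the ratio no longer depends on j. It governs
both the variance of the importance weights and the second-order term of the exponential weights. -/
theorem div_sqrtDist_sq (hp : ∀ j, 0 < p j) (j : Fin k) :
    p j / sqrtDist p j ^ 2 = halfNorm p := by
  have h1 := sum_sqrt_pos hp j
  have h2 := Real.sqrt_pos.mpr (hp j)
  rw [sqrtDist, div_pow, Real.sq_sqrt (hp j).le, halfNorm]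
  field_simp [(hp j).ne']

theorem sum_div_sqrtDist (hp : ∀ j, 0 < p j) : ∑ j, p j / sqrtDist p j = halfNorm p := by
  simp only [div_sqrtDist hp, ← Finset.sum_mul, halfNorm, sq]

theorem halfNorm_nonneg (p : Fin k → ℝ) : 0 ≤ halfNorm p := sq_nonneg _

theorem le_one_of_sum_eq_one (hp : ∀ j, 0 < p j) (hp1 : ∑ j, p j = 1) (j : Fin k) : p j ≤ 1 := by
  rw [← hp1]
  exact Finset.single_le_sum (fun i _ => (hp i).le) (Finset.mem_univ j)

theorem sum_sqrt_le (hp : ∀ j, 0 < p j) (hp1 : ∑ j, p j = 1) : ∑ l, √(p l) ≤ k := by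
  calc ∑ l, √(p l) ≤ ∑ _l : Fin k, (1 : ℝ) := Finset.sum_le_sum fun l _ =>
        Real.sqrt_le_one.mpr (le_one_of_sum_eq_one hp hp1 l)
    _ = k := by simp

theorem div_sqrtDist_le (hp : ∀ j, 0 < p j) (hp1 : ∑ j, p j = 1) (j : Fin k) :
    p j / sqrtDist p j ≤ k := by
  rw [div_sqrtDist hp]
  have h1 := sum_sqrt_le hp hp1
  have h2 : √(p j) ≤ 1 := Real.sqrt_le_one.mpr (le_one_of_sum_eq_one hp hp1 j)
  have h3 := sum_sqrt_pos hp j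
  nlinarith [Real.sqrt_nonneg (p j)]

theorem sum_mul_mem_Icc (hp : ∀ j, 0 < p j) (hp1 : ∑ j, p j = 1)
    (hx : ∀ j, x j ∈ Set.Icc (0 : ℝ) 1) : ∑ j, p j * x j ∈ Set.Icc (0 : ℝ) 1 := by
  refine ⟨Finset.sum_nonneg fun j _ => mul_nonneg (hp j).le (hx j).1, ?_⟩
  rw [← hp1]
  exact Finset.sum_le_sum fun j _ => mul_le_of_le_one_right (hp j).le (hx j).2

/-- The bonus β / q_j, scaled by β, pays exactly for the second-order term β² / q_j of the
exponential, so the estimate is an upper confidence bound at scale β. -/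
theorem sum_query_exp_estimate_le {β : ℝ} (hβ : 0 ≤ β) {q : Fin k → ℝ} (hq : ∀ j, 0 < q j)
    (hq1 : ∑ j, q j = 1) (hx : ∀ j, x j ∈ Set.Icc (0 : ℝ) 1) (j : Fin k) :
    ∑ b, q b * Real.exp (β * (x j - estimate β q x b j)) ≤ 1 := by
  have hqj := hq j
  set y : ℝ := β * x j / q j with hy
  have hy0 : 0 ≤ y := div_nonneg (mul_nonneg hβ (hx j).1) hqj.le
  -- The part not depending on the query, reward minus bonus, is factored out; only -y on the event
  -- b = j remains random.
  have hterm : ∀ b, q b * Real.exp (β * (x j - estimate β q x b j)) =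
      Real.exp (β * x j - β ^ 2 / q j) * (q b * Real.exp (-(if b = j then y else 0))) := by
    intro b
    rw [mul_left_comm, ← Real.exp_add]
    congr 2
    unfold estimate
    split_ifs
    · rw [hy]; field_simp; ring
    · field_simp; ring
  have hsum : ∑ b, q b * Real.exp (-(if b = j then y else 0)) ≤
      Real.exp (-(β * x j) + β ^ 2 / q j) := by
    calc ∑ b, q b * Real.exp (-(if b = j then y else 0))
        ≤ ∑ b, (q b + if b = j then q j * (y ^ 2 - y) else 0) := by
          refine Finset.sum_le_sum fun b _ => ?_
          split_ifs with h
          · subst h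
            have := exp_neg_le_quadratic hy0
            nlinarith
          · simp
      _ = 1 + q j * (y ^ 2 - y) := by
          rw [Finset.sum_add_distrib, hq1]; simp
      _ = 1 + (-(β * x j) + β ^ 2 * x j ^ 2 / q j) := by
          rw [hy]; field_simp; ring
      _ ≤ 1 + (-(β * x j) + β ^ 2 / q j) := by
          have : x j ^ 2 ≤ 1 := pow_le_one₀ (hx j).1 (hx j).2
          gcongr
          exact mul_le_of_le_one_right (sq_nonneg _) this
      _ ≤ _ := by linarith [Real.add_one_le_exp (-(β * x j) + β ^ 2 / q j)]
  simp only [hterm, ← Finset.mul_sum]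
  calc _ ≤ Real.exp (β * x j - β ^ 2 / q j) * Real.exp (-(β * x j) + β ^ 2 / q j) :=
        mul_le_mul_of_nonneg_left hsum (Real.exp_pos _).le
    _ = 1 := by rw [← Real.exp_add]; simp

/-- The weighted reward has mean ∑ p_j x_j and second moment at most ‖p‖_{1/2}, and lies in [0, k];
l * k ≤ 1 brings it within reach of the Bernstein bound. -/
theorem sum_query_exp_importance_le {l : ℝ} (hl : 0 ≤ l) (hlk : l * k ≤ 1) (hk : 0 < k)
    (hp : ∀ j, 0 < p j) (hp1 : ∑ j, p j = 1) (hx : ∀ j, x j ∈ Set.Icc (0 : ℝ) 1) :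
    ∑ b, sqrtDist p b * Real.exp (l * (p b / sqrtDist p b * x b - ∑ j, p j * x j)
      - l ^ 2 * halfNorm p) ≤ 1 := by
  have hq := sqrtDist_pos hp
  have hq1 := sum_sqrtDist hp hk
  set q := sqrtDist p with hqdef
  set m := ∑ j, p j * x j with hm
  obtain ⟨hm0, hm1⟩ := sum_mul_mem_Icc hp hp1 hx
  have hk1 : (1 : ℝ) ≤ k := by exact_mod_cast hk
  have hX0 : ∀ b, 0 ≤ p b / q b * x b := fun b =>
    mul_nonneg (div_nonneg (hp b).le (hq b).le) (hx b).1
  have hXk : ∀ b, p b / q b * x b ≤ k := fun b =>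
    (mul_le_of_le_one_right (div_nonneg (hp b).le (hq b).le) (hx b).2).trans
      (div_sqrtDist_le hp hp1 b)
  have hmean : ∑ b, q b * (p b / q b * x b) = m := by
    refine Finset.sum_congr rfl fun b _ => ?_
    have := (hq b).ne'
    field_simp
  have hvar : ∑ b, q b * (p b / q b * x b) ^ 2 ≤ halfNorm p := by
    calc ∑ b, q b * (p b / q b * x b) ^ 2 ≤ ∑ b, p b * halfNorm p := by
          refine Finset.sum_le_sum fun b _ => ?_
          rw [← div_sqrtDist_sq hp b, ← hqdef]
          have h1 := hq b
          have h2 : q b ≤ 1 := le_one_of_sum_eq_one hq hq1 b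
          have h3 : x b ^ 2 ≤ 1 := pow_le_one₀ (hx b).1 (hx b).2
          have h4 : q b * (p b / q b * x b) ^ 2 = (p b * (p b / q b ^ 2)) * (q b * x b ^ 2) := by
            field_simp
          rw [h4]
          refine mul_le_of_le_one_right ?_ (mul_le_one₀ h2 (sq_nonneg _) h3)
          have := (hp b).le
          positivity
      _ = halfNorm p := by rw [← Finset.sum_mul, hp1, one_mul]
  have key := sum_mul_exp_le_exp (p := q) (z := fun b => l * (p b / q b * x b - m))
    (s := l ^ 2 * halfNorm p) (fun b => (hq b).le) hq1 ?_ ?_ ?_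
  · simp only [Real.exp_sub (l * _), mul_div_assoc', ← Finset.sum_div]
    exact (div_le_one (Real.exp_pos _)).mpr key
  · intro b
    rw [abs_mul, abs_of_nonneg hl]
    refine (mul_le_mul_of_nonneg_left ?_ hl).trans hlk
    exact abs_sub_le_iff.mpr ⟨by linarith [hXk b], by linarith [hX0 b]⟩
  · have : ∀ b, q b * (l * (p b / q b * x b - m)) =
        l * (q b * (p b / q b * x b)) - l * m * q b := fun b => by ring
    simp only [this, Finset.sum_sub_distrib, ← Finset.mul_sum, hmean, hq1]
    ring
  · have : ∀ b, q b * (l * (p b / q b * x b - m)) ^ 2 =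
        l ^ 2 * (q b * (p b / q b * x b) ^ 2) - 2 * l ^ 2 * m * (q b * (p b / q b * x b))
          + l ^ 2 * m ^ 2 * q b := fun b => by ring
    simp only [this, Finset.sum_sub_distrib, Finset.sum_add_distrib, ← Finset.mul_sum, hmean, hq1]
    nlinarith [mul_le_mul_of_nonneg_left hvar (sq_nonneg l), sq_nonneg (l * m)]

theorem sum_action_exp_le {l : ℝ} (hl : 0 ≤ l) (hl1 : l ≤ 1)
    (hp : ∀ j, 0 < p j) (hp1 : ∑ j, p j = 1) (hx : ∀ j, x j ∈ Set.Icc (0 : ℝ) 1) :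
    ∑ i, p i * Real.exp (l * (∑ j, p j * x j - x i) - l ^ 2) ≤ 1 := by
  obtain ⟨hm0, hm1⟩ := sum_mul_mem_Icc hp hp1 hx
  set m := ∑ j, p j * x j with hm
  have habs : ∀ i, |m - x i| ≤ 1 := fun i =>
    abs_sub_le_iff.mpr ⟨by linarith [(hx i).1], by linarith [(hx i).2]⟩
  have key := sum_mul_exp_le_exp (p := p) (z := fun i => l * (m - x i)) (s := l ^ 2)
    (fun i => (hp i).le) hp1 ?_ ?_ ?_
  · simp only [Real.exp_sub (l * _), mul_div_assoc', ← Finset.sum_div]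
    exact (div_le_one (Real.exp_pos _)).mpr key
  · intro i
    rw [abs_mul, abs_of_nonneg hl]
    exact mul_le_one₀ hl1 (abs_nonneg _) (habs i)
  · have : ∀ i, p i * (l * (m - x i)) = l * m * p i - l * (p i * x i) := fun i => by ring
    simp only [this, Finset.sum_sub_distrib, ← Finset.mul_sum, hp1]
    rw [← hm]; ring
  · calc ∑ i, p i * (l * (m - x i)) ^ 2 ≤ ∑ i, p i * l ^ 2 := by
          refine Finset.sum_le_sum fun i _ => mul_le_mul_of_nonneg_left ?_ (hp i).le
          rw [mul_pow]
          exact mul_le_of_le_one_right (sq_nonneg _) (sq_le_one_iff_abs_le_one _ |>.mpr (habs i))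
      _ = l ^ 2 := by rw [← Finset.sum_mul, hp1, one_mul]

theorem estimate_nonneg {β : ℝ} (hβ : 0 ≤ β) {q : Fin k → ℝ} (hq : ∀ j, 0 < q j)
    (hx : ∀ j, x j ∈ Set.Icc (0 : ℝ) 1) (b j : Fin k) : 0 ≤ estimate β q x b j := by
  have h1 := (hx j).1
  have h2 := (hq j).le
  unfold estimate
  split_ifs <;> positivity

theorem estimate_le {β : ℝ} {q : Fin k → ℝ} (hq : ∀ j, 0 < q j)
    (hx : ∀ j, x j ∈ Set.Icc (0 : ℝ) 1) (b j : Fin k) :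
    estimate β q x b j ≤ (1 + β) / q j := by
  have h1 := (hx j).2
  have h2 := (hq j).le
  unfold estimate
  rw [div_eq_mul_one_div (1 + β), mul_comm (1 + β)]
  refine mul_le_mul_of_nonneg_left ?_ (by positivity)
  split_ifs <;> linarith

theorem sum_mul_estimate {β : ℝ} (hp : ∀ j, 0 < p j) (b : Fin k) :
    ∑ j, p j * estimate β (sqrtDist p) x b j =
      p b / sqrtDist p b * x b + β * halfNorm p := by
  have : ∀ j, p j * estimate β (sqrtDist p) x b j =
      (if b = j then p j / sqrtDist p j * x j else 0) + β * (p j / sqrtDist p j) := by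
    intro j
    unfold estimate
    split_ifs <;> ring
  simp only [this, Finset.sum_add_distrib, ← Finset.mul_sum, sum_div_sqrtDist hp]
  simp

/-- The common factor p_j / q_j² comes out. The queried action contributes at most (1 + β)² ≤ 2,
every other one only β². -/
theorem sum_mul_estimate_sq_le {β : ℝ} (hβ2 : (1 + β) ^ 2 ≤ 2) (hp : ∀ j, 0 < p j)
    (hx : ∀ j, x j ∈ Set.Icc (0 : ℝ) 1) (b : Fin k) :
    ∑ j, p j * estimate β (sqrtDist p) x b j ^ 2 ≤ (2 + k * β ^ 2) * halfNorm p := by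
  calc ∑ j, p j * estimate β (sqrtDist p) x b j ^ 2
      = ∑ j, halfNorm p * (x j * (if b = j then 1 else 0) + β) ^ 2 := by
        refine Finset.sum_congr rfl fun j _ => ?_
        rw [← div_sqrtDist_sq hp j, estimate]
        ring
    _ ≤ ∑ j, halfNorm p * ((if b = j then 2 else 0) + β ^ 2) := by
        refine Finset.sum_le_sum fun j _ => mul_le_mul_of_nonneg_left ?_ (halfNorm_nonneg p)
        have h0 := (hx j).1
        have h1 := (hx j).2
        split_ifs <;> nlinarith
    _ = (2 + k * β ^ 2) * halfNorm p := by
        rw [← Finset.mul_sum, Finset.sum_add_distrib]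
        simp
        ring

end OneRound

/-! ### Exponential supermartingales along the run. -/

section Concentration

theorem tsum_bind_mul {α β : Type*} (p : PMF α) (f : α → PMF β) (G : β → ℝ≥0∞) :
    ∑' b, p.bind f b * G b = ∑' a, p a * ∑' b, f a b * G b := by
  simp only [PMF.bind_apply, ← ENNReal.tsum_mul_right, ← ENNReal.tsum_mul_left]
  rw [ENNReal.tsum_comm]
  simp only [mul_assoc]

theorem tsum_pure_mul {α : Type*} (a : α) (G : α → ℝ≥0∞) :
    ∑' b, PMF.pure a b * G b = G a := by
  rw [tsum_eq_single a]
  · simp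
  · intro b hb; simp [hb]

theorem tsum_map_mul {α β : Type*} (p : PMF α) (f : α → β) (G : β → ℝ≥0∞) :
    ∑' b, p.map f b * G b = ∑' a, p a * G (f a) := by
  rw [← PMF.bind_pure_comp, tsum_bind_mul]
  simp only [Function.comp, tsum_pure_mul]

variable {k T S : ℕ} {μ δ : ℝ}

/-- The sum over the rounds of a run of quantities depending on the past and on the two draws of
the round. -/
noncomputable def pathSum (F : (n : ℕ) → (Fin n → Fin k × Fin k) → Fin k → Fin k → ℝ) (n : ℕ)
    (h : Fin n → Fin k × Fin k) : ℝ :=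
  ∑ t : Fin n, F t (Fin.take (t : ℕ) t.isLt.le h) (h t).1 (h t).2

theorem pathSum_snoc (F : (n : ℕ) → (Fin n → Fin k × Fin k) → Fin k → Fin k → ℝ) (n : ℕ)
    (h : Fin n → Fin k × Fin k) (i j : Fin k) :
    pathSum F (n + 1) (Fin.snoc (α := fun _ => Fin k × Fin k) h (i, j)) =
      pathSum F n h + F n h i j := by
  have htake : ∀ (m : ℕ) (hm : m ≤ n) (hm' : m ≤ n + 1),
      Fin.take m hm' (Fin.snoc (α := fun _ => Fin k × Fin k) h (i, j)) = Fin.take m hm h := by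
    intro m hm hm'
    funext a
    simp only [Fin.take]
    have : Fin.castLE hm' a = (Fin.castLE hm a).castSucc := rfl
    rw [this, Fin.snoc_castSucc]
  unfold pathSum
  rw [Fin.sum_univ_castSucc]
  congr 1
  · refine Finset.sum_congr rfl fun t _ => ?_
    rw [Fin.snoc_castSucc]
    simp only [Fin.val_castSucc]
    rw [htake t t.isLt.le]
  · rw [Fin.snoc_last]
    simp only [Fin.val_last]
    rw [htake n le_rfl]
    rfl

/-- Supermartingale argument: the last round is integrated out given its past, contributing a factor
of at most 1. -/
theorem tsum_law_mul_exp_pathSum_le (hk : 1 < k) (hγ : gamma k T S μ δ ≤ 1) (g : ℕ → Fin k → ℝ)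
    (F : (n : ℕ) → (Fin n → Fin k × Fin k) → Fin k → Fin k → ℝ) (n : ℕ)
    (hF : ∀ m < n, ∀ h, ∑ i, actionProb k T S μ δ g m h i *
      ∑ j, queryProb k T S μ δ g m h j * Real.exp (F m h i j) ≤ 1) :
    ∑' ω, law hk hγ g n ω * ENNReal.ofReal (Real.exp (pathSum F n ω)) ≤ 1 := by
  induction n with
  | zero =>
    rw [law, tsum_pure_mul]
    simp [pathSum]
  | succ n ih =>
    rw [law, tsum_bind_mul]
    refine le_trans (ENNReal.tsum_le_tsum fun h => ?_) (ih fun m hm => hF m (by omega))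
    refine mul_le_mul_right ?_ _
    rw [tsum_bind_mul]
    simp only [tsum_map_mul, pathSum_snoc, Real.exp_add]
    have hround := hF n (by omega) h
    have hq := queryProb_nonneg (T := T) (S := S) (μ := μ) (δ := δ) (g := g) n h
    have hp := actionProb_nonneg (g := g) hγ n h
    have hinner : ∀ i, ∑' j, queryLaw T S μ δ hk g n h j *
        ENNReal.ofReal (Real.exp (pathSum F n h) * Real.exp (F n h i j)) =
        ENNReal.ofReal (Real.exp (pathSum F n h) *
          ∑ j, queryProb k T S μ δ g n h j * Real.exp (F n h i j)) := by
      intro i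
      rw [tsum_fintype, Finset.mul_sum, ENNReal.ofReal_sum_of_nonneg]
      · refine Finset.sum_congr rfl fun j _ => ?_
        rw [queryLaw, PMF.ofFintype_apply, ← ENNReal.ofReal_mul (hq j)]
        congr 1; ring
      · exact fun j _ => mul_nonneg (Real.exp_pos _).le (mul_nonneg (hq j) (Real.exp_pos _).le)
    simp only [hinner]
    have houter : ∀ i, actionLaw hk hγ g n h i * ENNReal.ofReal (Real.exp (pathSum F n h) *
          ∑ j, queryProb k T S μ δ g n h j * Real.exp (F n h i j)) =
        ENNReal.ofReal (Real.exp (pathSum F n h) * (actionProb k T S μ δ g n h i *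
          ∑ j, queryProb k T S μ δ g n h j * Real.exp (F n h i j))) := by
      intro i
      rw [actionLaw, PMF.ofFintype_apply, ← ENNReal.ofReal_mul (hp i)]
      congr 1; ring
    simp only [houter]
    rw [tsum_fintype, ← ENNReal.ofReal_sum_of_nonneg, ← Finset.mul_sum]
    · exact ENNReal.ofReal_le_ofReal (mul_le_of_le_one_right (Real.exp_pos _).le hround)
    · exact fun i _ => mul_nonneg (Real.exp_pos _).le (mul_nonneg (hp i)
        (Finset.sum_nonneg fun j _ => mul_nonneg (hq j) (Real.exp_pos _).le))

/-- Markov's inequality for exp(`pathSum`). -/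
theorem law_pathSum_gt_le (hk : 1 < k) (hγ : gamma k T S μ δ ≤ 1) (g : ℕ → Fin k → ℝ)
    (F : (n : ℕ) → (Fin n → Fin k × Fin k) → Fin k → Fin k → ℝ) (n : ℕ)
    (hF : ∀ m < n, ∀ h, ∑ i, actionProb k T S μ δ g m h i *
      ∑ j, queryProb k T S μ δ g m h j * Real.exp (F m h i j) ≤ 1) (b : ℝ) :
    (law hk hγ g n).toMeasure.real {ω | b < pathSum F n ω} ≤ Real.exp (-b) := by
  have h := tsum_law_mul_exp_pathSum_le hk hγ g F n hF
  rw [MeasureTheory.measureReal_def]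
  refine ENNReal.toReal_le_of_le_ofReal (Real.exp_pos _).le ?_
  rw [PMF.toMeasure_apply _ (Set.toFinite _).measurableSet]
  calc ∑' ω, ({ω | b < pathSum F n ω} : Set _).indicator (law hk hγ g n) ω
      ≤ ∑' ω, ENNReal.ofReal (Real.exp (-b)) *
          (law hk hγ g n ω * ENNReal.ofReal (Real.exp (pathSum F n ω))) := by
        refine ENNReal.tsum_le_tsum fun ω => ?_
        by_cases hω : b < pathSum F n ω
        · rw [Set.indicator_of_mem (by exact hω), mul_left_comm, ← ENNReal.ofReal_mul (Real.exp_pos _).le,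
            ← Real.exp_add]
          refine le_mul_of_one_le_right' ?_
          rw [ENNReal.one_le_ofReal]
          exact Real.one_le_exp (by linarith)
        · rw [Set.indicator_of_notMem (by exact hω)]; exact zero_le
    _ ≤ ENNReal.ofReal (Real.exp (-b)) * 1 := by
        rw [ENNReal.tsum_mul_left]
        exact mul_le_mul_right h _
    _ = _ := mul_one _

end Concentration

/-! ### Deterministic analysis of exponential weights with sharing. -/

section FixedShare

theorem sum_succ_sub_castSucc {m : ℕ} (f : Fin (m + 1) → ℝ) :
    ∑ s : Fin m, (f s.succ - f s.castSucc) = f (Fin.last m) - f 0 := by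
  induction m with
  | zero => simp
  | succ m ih =>
    rw [Fin.sum_univ_castSucc]
    have := ih fun s => f s.castSucc
    simp only [Fin.succ_castSucc, Fin.castSucc_zero, Fin.succ_last] at this ⊢
    rw [this]
    ring

variable {k : ℕ} {a η : ℝ} {w x : ℕ → Fin k → ℝ}

theorem sum_succ_fixedShare (hk : 0 < k)
    (hw : ∀ n j, w (n + 1) j = w n j * Real.exp (η * x n j) + Real.exp 1 * a / k * ∑ i, w n i)
    (n : ℕ) : ∑ j, w (n + 1) j =
      ∑ j, w n j * Real.exp (η * x n j) + Real.exp 1 * a * ∑ i, w n i := by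
  have : (k : ℝ) ≠ 0 := by positivity
  simp only [hw, Finset.sum_add_distrib, Finset.sum_const, Finset.card_univ, Fintype.card_fin,
    nsmul_eq_mul]
  field_simp

/-- Uses e^y ≤ 1 + y + y² on [0, 1] and 1 + u ≤ e^u; sharing adds e·a times the total weight. -/
theorem log_sum_succ_fixedShare_le (hk : 0 < k) (hpos : ∀ n j, 0 < w n j)
    (hw : ∀ n j, w (n + 1) j = w n j * Real.exp (η * x n j) + Real.exp 1 * a / k * ∑ i, w n i)
    (n : ℕ) (hx : ∀ j, η * x n j ∈ Set.Icc (0 : ℝ) 1) :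
    Real.log (∑ j, w (n + 1) j) ≤ Real.log (∑ j, w n j) + Real.exp 1 * a +
      ∑ j, w n j / (∑ i, w n i) * (η * x n j + (η * x n j) ^ 2) := by
  have hne : (Finset.univ : Finset (Fin k)).Nonempty := ⟨⟨0, hk⟩, Finset.mem_univ _⟩
  have hW : ∀ n, 0 < ∑ j, w n j := fun n => Finset.sum_pos (fun j _ => hpos n j) hne
  set D := ∑ j, w n j / (∑ i, w n i) * (η * x n j + (η * x n j) ^ 2) with hD
  have h1 : ∑ j, w (n + 1) j ≤ (∑ j, w n j) * (1 + (Real.exp 1 * a + D)) := by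
    rw [sum_succ_fixedShare hk hw]
    have hsum : (∑ j, w n j) * D = ∑ j, w n j * (η * x n j + (η * x n j) ^ 2) := by
      rw [hD, Finset.mul_sum]
      refine Finset.sum_congr rfl fun j _ => ?_
      have := (hW n).ne'
      field_simp
    have h2 : ∑ j, w n j * Real.exp (η * x n j) ≤
        ∑ j, (w n j + w n j * (η * x n j + (η * x n j) ^ 2)) := by
      refine Finset.sum_le_sum fun j _ => ?_
      have h3 := (abs_le.mp (Real.abs_exp_sub_one_sub_id_le
        (abs_le.mpr ⟨by linarith [(hx j).1], (hx j).2⟩))).2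
      nlinarith [hpos n j]
    rw [Finset.sum_add_distrib, ← hsum] at h2
    linarith
  have h3 : ∑ j, w (n + 1) j ≤ (∑ j, w n j) * Real.exp (Real.exp 1 * a + D) :=
    h1.trans (mul_le_mul_of_nonneg_left
      (by linarith [Real.add_one_le_exp (Real.exp 1 * a + D)]) (hW n).le)
  have h4 := Real.log_le_log (hW (n + 1)) h3
  rw [Real.log_mul (hW n).ne' (Real.exp_pos _).ne', Real.log_exp] at h4
  linarith

/-- One round multiplies the total by at most e + e·a ≤ 2e, while sharing alone hands each action
e·a/k of the old total; e cancels in the ratio. -/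
theorem sum_fixedShare_le (hk : 0 < k) (ha : 0 < a) (ha1 : a ≤ 1) (hpos : ∀ n j, 0 < w n j)
    (h0 : ∀ j, w 0 j = 1)
    (hw : ∀ n j, w (n + 1) j = w n j * Real.exp (η * x n j) + Real.exp 1 * a / k * ∑ i, w n i)
    {T : ℕ} (hx : ∀ n < T, ∀ j, η * x n j ∈ Set.Icc (0 : ℝ) 1) {n : ℕ} (hn : n ≤ T) (j : Fin k) :
    ∑ i, w n i ≤ 2 * k / a * w n j := by
  have hk1 : (1 : ℝ) ≤ k := by exact_mod_cast hk
  cases n with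
  | zero =>
    simp only [h0, Finset.sum_const, Finset.card_univ, Fintype.card_fin, nsmul_eq_mul, mul_one]
    rw [le_div_iff₀ ha]
    nlinarith
  | succ n =>
    have hW : 0 < ∑ i, w n i := Finset.sum_pos (fun i _ => hpos n i) ⟨j, Finset.mem_univ _⟩
    have he : 0 < Real.exp 1 := Real.exp_pos 1
    have h1 : ∑ i, w (n + 1) i ≤ 2 * Real.exp 1 * ∑ i, w n i := by
      rw [sum_succ_fixedShare hk hw]
      have h2 : ∑ i, w n i * Real.exp (η * x n i) ≤ ∑ i, w n i * Real.exp 1 :=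
        Finset.sum_le_sum fun i _ => mul_le_mul_of_nonneg_left
          (Real.exp_le_exp.mpr (hx n (by omega) i).2) (hpos n i).le
      rw [← Finset.sum_mul] at h2
      have h3 : Real.exp 1 * a * ∑ i, w n i ≤ Real.exp 1 * ∑ i, w n i :=
        mul_le_mul_of_nonneg_right (mul_le_of_le_one_right he.le ha1) hW.le
      linarith
    have h2 : Real.exp 1 * a / k * ∑ i, w n i ≤ w (n + 1) j := by
      rw [hw]
      have := mul_pos (hpos n j) (Real.exp_pos (η * x n j))
      linarith
    calc ∑ i, w (n + 1) i ≤ 2 * Real.exp 1 * ∑ i, w n i := h1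
      _ = 2 * k / a * (Real.exp 1 * a / k * ∑ i, w n i) := by field_simp
      _ ≤ _ := by gcongr

theorem mul_exp_sum_Ico_le (ha : 0 ≤ a) (hpos : ∀ n j, 0 < w n j)
    (hw : ∀ n j, w (n + 1) j = w n j * Real.exp (η * x n j) + Real.exp 1 * a / k * ∑ i, w n i)
    {m n : ℕ} (hmn : m ≤ n) (j : Fin k) :
    w m j * Real.exp (η * ∑ t ∈ Finset.Ico m n, x t j) ≤ w n j := by
  induction n, hmn using Nat.le_induction with
  | base => simp
  | succ n hmn ih =>
    rw [Finset.sum_Ico_succ_top hmn, mul_add, Real.exp_add, ← mul_assoc, hw]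
    have h1 : 0 ≤ ∑ i, w n i := Finset.sum_nonneg fun i _ => (hpos n i).le
    have h2 : 0 ≤ Real.exp 1 * a / k * ∑ i, w n i := by positivity
    have h3 := mul_le_mul_of_nonneg_right ih (Real.exp_pos (η * x n j)).le
    linarith

/-- An action starts any epoch with share at least a/(2k), its weight then grows at least
exponentially in its estimated gain, and it never exceeds the total. The potential difference
telescopes over epochs. -/
theorem epoch_gain_le (hk : 0 < k) (ha : 0 < a) (ha1 : a ≤ 1) (hpos : ∀ n j, 0 < w n j)
    (h0 : ∀ j, w 0 j = 1)
    (hw : ∀ n j, w (n + 1) j = w n j * Real.exp (η * x n j) + Real.exp 1 * a / k * ∑ i, w n i)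
    {T : ℕ} (hx : ∀ n < T, ∀ j, η * x n j ∈ Set.Icc (0 : ℝ) 1) {m n : ℕ} (hmn : m ≤ n)
    (hn : n ≤ T) (j : Fin k) :
    η * ∑ t ∈ Finset.Ico m n, x t j ≤
      Real.log (2 * k / a) + (Real.log (∑ i, w n i) - Real.log (∑ i, w m i)) := by
  have hW : ∀ n, 0 < ∑ i, w n i := fun n =>
    Finset.sum_pos (fun i _ => hpos n i) ⟨j, Finset.mem_univ _⟩
  have hc : 0 < 2 * k / a := by positivity
  have h1 := sum_fixedShare_le hk ha ha1 hpos h0 hw hx (hmn.trans hn) j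
  have h2 := mul_exp_sum_Ico_le ha.le hpos hw hmn j
  have h3 : w n j ≤ ∑ i, w n i :=
    Finset.single_le_sum (fun i _ => (hpos n i).le) (Finset.mem_univ j)
  have h4 : (∑ i, w m i) * Real.exp (η * ∑ t ∈ Finset.Ico m n, x t j) ≤
      2 * k / a * ∑ i, w n i := by
    calc _ ≤ 2 * k / a * w m j * Real.exp (η * ∑ t ∈ Finset.Ico m n, x t j) :=
          mul_le_mul_of_nonneg_right h1 (Real.exp_pos _).le
      _ = 2 * k / a * (w m j * Real.exp (η * ∑ t ∈ Finset.Ico m n, x t j)) := by ring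
      _ ≤ _ := mul_le_mul_of_nonneg_left (h2.trans h3) hc.le
  have h5 := Real.log_le_log (mul_pos (hW m) (Real.exp_pos _)) h4
  rw [Real.log_mul (hW m).ne' (Real.exp_pos _).ne', Real.log_exp,
    Real.log_mul hc.ne' (hW n).ne'] at h5
  linarith

theorem segmentation_gain_le (hk : 0 < k) {T S : ℕ} (hT : 1 ≤ T) (hpos : ∀ n j, 0 < w n j)
    (h0 : ∀ j, w 0 j = 1)
    (hw : ∀ n j, w (n + 1) j =
      w n j * Real.exp (η * x n j) + Real.exp 1 * alpha T / k * ∑ i, w n i)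
    (hx : ∀ n < T, ∀ j, η * x n j ∈ Set.Icc (0 : ℝ) 1)
    {τ : Fin (S + 1) → ℕ} (hτ : IsSegmentation T S τ) (i : Fin S → Fin k) :
    η * ∑ s : Fin S, ∑ t ∈ Finset.Ico (τ s.castSucc) (τ s.succ), x t (i s) ≤
      S * Real.log (2 * k * T) + Real.exp 1 +
        ∑ n ∈ Finset.range T, ∑ j, w n j / (∑ l, w n l) * (η * x n j + (η * x n j) ^ 2) := by
  obtain ⟨hmono, hτ0, hτT⟩ := hτ
  have hT0 : (0 : ℝ) < T := by exact_mod_cast hT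
  have ha : 0 < alpha T := by unfold alpha; positivity
  have ha1 : alpha T ≤ 1 := by
    unfold alpha
    exact (div_le_one hT0).mpr (by exact_mod_cast hT)
  have hc : 2 * (k : ℝ) / alpha T = 2 * k * T := by unfold alpha; field_simp
  have hle : ∀ s, τ s ≤ T := fun s => hτT ▸ hmono (Fin.le_last s)
  have hlow : η * ∑ s : Fin S, ∑ t ∈ Finset.Ico (τ s.castSucc) (τ s.succ), x t (i s) ≤
      S * Real.log (2 * k * T) + (Real.log (∑ l, w T l) - Real.log (∑ l, w 0 l)) := by
    rw [Finset.mul_sum]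
    refine (Finset.sum_le_sum fun s _ => epoch_gain_le hk ha ha1 hpos h0 hw hx
      (hmono (Fin.castSucc_le_succ s)) (hle _) (i s)).trans_eq ?_
    rw [Finset.sum_add_distrib, hc]
    congr 1
    · simp
    · rw [sum_succ_sub_castSucc fun s => Real.log (∑ l, w (τ s) l), hτ0, hτT]
  have hup : ∀ N ≤ T, Real.log (∑ l, w N l) ≤ Real.log (∑ l, w 0 l) + N * (Real.exp 1 * alpha T) +
      ∑ n ∈ Finset.range N, ∑ j, w n j / (∑ l, w n l) * (η * x n j + (η * x n j) ^ 2) := by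
    intro N hN
    induction N with
    | zero => simp
    | succ N ih =>
      have h1 := ih (by omega)
      have h2 := log_sum_succ_fixedShare_le hk hpos hw N (hx N (by omega))
      rw [Finset.sum_range_succ]
      push_cast
      linarith
  have h1 := hup T le_rfl
  -- With a = 1/T, sharing costs only e over the whole run.
  have h2 : (T : ℝ) * (Real.exp 1 * alpha T) = Real.exp 1 := by unfold alpha; field_simp
  linarith

end FixedShare

/-! ### Consequences of the choice of η, β and γ. -/

section Parameters

variable {k T S : ℕ} {μ δ : ℝ}

theorem eta_pos (hT : 1 ≤ T) (hS : 1 ≤ S) (hμ : 1 ≤ μ) : 0 < eta T S μ := by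
  have : (0 : ℝ) < S := by exact_mod_cast hS
  have : (0 : ℝ) < T := by exact_mod_cast hT
  unfold eta
  positivity

theorem eta_sq (hμ : 1 ≤ μ) : eta T S μ ^ 2 = S / (μ * T) := by
  unfold eta
  exact Real.sq_sqrt (by positivity)

theorem one_le_log_three_mul_div (hk : 1 < k) (hδ : δ ∈ Set.Ioo (0 : ℝ) 1) :
    1 ≤ Real.log (3 * k / δ) := by
  have hk2 : (2 : ℝ) ≤ k := by exact_mod_cast hk
  have hδ0 := hδ.1
  rw [Real.le_log_iff_exp_le (by positivity), le_div_iff₀ hδ0]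
  nlinarith [Real.exp_one_lt_d9, hδ.2, Real.exp_pos 1]

theorem two_mul_eta_le_beta (hk : 1 < k) (hδ : δ ∈ Set.Ioo (0 : ℝ) 1) :
    2 * eta T S μ ≤ beta k T S μ δ := by
  have h1 := one_le_log_three_mul_div hk hδ
  have h2 : 1 ≤ √(6 * Real.log (3 * k / δ)) := Real.one_le_sqrt.mpr (by linarith)
  have h3 : 0 ≤ eta T S μ := Real.sqrt_nonneg _
  unfold beta
  nlinarith

theorem beta_pos (hk : 1 < k) (hT : 1 ≤ T) (hS : 1 ≤ S) (hμ : 1 ≤ μ)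
    (hδ : δ ∈ Set.Ioo (0 : ℝ) 1) : 0 < beta k T S μ δ := by
  have h1 : 2 * eta T S μ ≤ beta k T S μ δ := two_mul_eta_le_beta hk hδ
  linarith [eta_pos hT hS hμ]

theorem eta_mul_le_one (hβ0 : 0 ≤ beta k T S μ δ) (hγ : gamma k T S μ δ ≤ 1) :
    eta T S μ * k ≤ 1 := by
  have h1 : 0 ≤ eta T S μ := Real.sqrt_nonneg _
  have h2 : (eta T S μ * k) ^ 2 ≤ gamma k T S μ δ := by
    have h3 : 1 ≤ (1 + beta k T S μ δ) ^ 2 := by nlinarith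
    unfold gamma
    nlinarith [mul_nonneg (sq_nonneg (eta T S μ)) (sq_nonneg (k : ℝ))]
  exact (sq_le_one_iff₀ (by positivity)).mp (h2.trans hγ)

theorem gamma_pos (hk : 1 < k) (hη : 0 < eta T S μ) (hβ0 : 0 ≤ beta k T S μ δ) :
    0 < gamma k T S μ δ := by
  have : (0 : ℝ) < k := by positivity
  unfold gamma
  positivity

variable {g : ℕ → Fin k → ℝ}

theorem gamma_div_le_actionProb (hγ : gamma k T S μ δ ≤ 1) (n : ℕ)
    (h : Fin n → Fin k × Fin k) (j : Fin k) :
    gamma k T S μ δ / k ≤ actionProb k T S μ δ g n h j := by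
  have hw := weight_pos (T := T) (S := S) (μ := μ) (δ := δ) (g := g) n h
  have hs : 0 ≤ ∑ i, weight k T S μ δ g n h i := Finset.sum_nonneg fun i _ => (hw i).le
  exact le_add_of_nonneg_left (mul_nonneg (by linarith) (div_nonneg (hw j).le hs))

theorem mul_weight_div_le_actionProb (n : ℕ)
    (h : Fin n → Fin k × Fin k) (j : Fin k) :
    (1 - gamma k T S μ δ) * (weight k T S μ δ g n h j / ∑ i, weight k T S μ δ g n h i) ≤
      actionProb k T S μ δ g n h j :=
  le_add_of_nonneg_right (div_nonneg (gamma_nonneg _ _ _ _ _) (Nat.cast_nonneg _))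

theorem actionProb_pos (hγ0 : 0 < gamma k T S μ δ) (hγ : gamma k T S μ δ ≤ 1) (n : ℕ)
    (h : Fin n → Fin k × Fin k) (j : Fin k) : 0 < actionProb k T S μ δ g n h j := by
  have : 0 < k := j.pos
  exact lt_of_lt_of_le (by positivity) (gamma_div_le_actionProb hγ n h j)

/-- Since p_j ≥ γ/k and ∑ √p_l ≤ √k by Cauchy–Schwarz, q_j ≥ √γ/k = η(1 + β). This is what dictates
γ: it keeps η times the estimate in [0, 1]. -/
theorem eta_mul_le_queryProb (hk : 1 < k)
    (hγ0 : 0 < gamma k T S μ δ) (hγ : gamma k T S μ δ ≤ 1) (n : ℕ)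
    (h : Fin n → Fin k × Fin k) (j : Fin k) :
    eta T S μ * (1 + beta k T S μ δ) ≤ queryProb k T S μ δ g n h j := by
  have hp := actionProb_pos (g := g) hγ0 hγ n h
  have hp1 := sum_actionProb (T := T) (S := S) (μ := μ) (δ := δ) (g := g) hk n h
  have hlow := gamma_div_le_actionProb (g := g) hγ n h j
  have hη : 0 ≤ eta T S μ := Real.sqrt_nonneg _
  have hk0 : (0 : ℝ) < k := by positivity
  rw [queryProb, sqrtDist, le_div_iff₀ (sum_sqrt_pos hp j)]
  refine Real.le_sqrt_of_sq_le (le_trans ?_ hlow)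
  have hcs : (∑ l, √(actionProb k T S μ δ g n h l)) ^ 2 ≤ k := by
    have h1 := sq_sum_le_card_mul_sum_sq (s := (Finset.univ : Finset (Fin k)))
      (f := fun l => √(actionProb k T S μ δ g n h l))
    simp only [Real.sq_sqrt (hp _).le, hp1] at h1
    simpa using h1
  rw [mul_pow, mul_pow, le_div_iff₀ hk0, gamma]
  nlinarith [mul_le_mul_of_nonneg_left hcs (mul_nonneg (mul_nonneg (sq_nonneg (eta T S μ))
    (sq_nonneg (1 + beta k T S μ δ))) hk0.le)]

end Parameters

/-! ### Regret decomposition and the three deviation processes. -/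

section Regret

variable {k T S : ℕ} {μ δ : ℝ} {g : ℕ → Fin k → ℝ}

/-- The estimated gain of any segmentation is controlled by the importance-weighted estimates of
the gain of the algorithm and by the numbers `‖p(t)‖_{1/2}`. -/
theorem estimated_gain_le (hk : 1 < k) (hT : 1 ≤ T) (hS : 1 ≤ S) (hμ : 1 ≤ μ)
    (hδ : δ ∈ Set.Ioo (0 : ℝ) 1) (hβ2 : (1 + beta k T S μ δ) ^ 2 ≤ 2)
    (hγ : gamma k T S μ δ ≤ 1)
    (hg : ∀ n < T, ∀ i, g (n + 1) i ∈ Set.Icc (0 : ℝ) 1) (ζ : ℕ → Fin k × Fin k)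
    {τ : Fin (S + 1) → ℕ} (hτ : IsSegmentation T S τ) (a : Fin S → Fin k) :
    (1 - gamma k T S μ δ) * ∑ s : Fin S, ∑ n ∈ Finset.Ico (τ s.castSucc) (τ s.succ),
        estimate (beta k T S μ δ) (queryProb k T S μ δ g n fun i => ζ i) (g (n + 1)) (ζ n).2 (a s) ≤
      (S * Real.log (2 * k * T) + Real.exp 1) / eta T S μ +
        ∑ n ∈ Finset.range T, (actionProb k T S μ δ g n (fun i => ζ i) (ζ n).2 /
            queryProb k T S μ δ g n (fun i => ζ i) (ζ n).2 * g (n + 1) (ζ n).2 +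
          3 * beta k T S μ δ * halfNorm (actionProb k T S μ δ g n fun i => ζ i)) := by
  have hη := eta_pos hT hS hμ
  have hβ := beta_pos hk hT hS hμ hδ
  have hγ0 := gamma_pos hk hη hβ.le
  have hηk := eta_mul_le_one hβ.le hγ
  have hηβ : 2 * eta T S μ ≤ beta k T S μ δ := two_mul_eta_le_beta hk hδ
  set η := eta T S μ with hηdef
  set β := beta k T S μ δ with hβdef
  set γ := gamma k T S μ δ with hγdef
  set w : ℕ → Fin k → ℝ := fun n => weight k T S μ δ g n fun i => ζ i with hw
  set p : ℕ → Fin k → ℝ := fun n => actionProb k T S μ δ g n fun i => ζ i with hp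
  set q : ℕ → Fin k → ℝ := fun n => queryProb k T S μ δ g n fun i => ζ i with hq
  set x : ℕ → Fin k → ℝ := fun n j => estimate β (q n) (g (n + 1)) (ζ n).2 j with hx
  have hppos : ∀ n j, 0 < p n j := fun n j => actionProb_pos hγ0 hγ n _ j
  have hqpos : ∀ n j, 0 < q n j := fun n j => sqrtDist_pos (hppos n) j
  have hx0 : ∀ n < T, ∀ j, 0 ≤ x n j := fun n hn j =>
    estimate_nonneg hβ.le (hqpos n) (hg n hn) _ _
  have hx1 : ∀ n < T, ∀ j, η * x n j ∈ Set.Icc (0 : ℝ) 1 := by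
    intro n hn j
    refine ⟨mul_nonneg hη.le (hx0 n hn j), ?_⟩
    have h1 := estimate_le (β := β) (hqpos n) (hg n hn) (ζ n).2 j
    have h2 : η * (1 + β) ≤ q n j := eta_mul_le_queryProb hk hγ0 hγ n _ j
    calc η * x n j ≤ η * ((1 + β) / q n j) := mul_le_mul_of_nonneg_left h1 hη.le
      _ = η * (1 + β) / q n j := by ring
      _ ≤ 1 := (div_le_one (hqpos n j)).mpr h2
  have hgain := segmentation_gain_le (k := k) (η := η) (w := w) (x := x) (by omega) hT
    (fun n j => weight_pos n _ j) (fun j => rfl) (fun n j => rfl) hx1 hτ a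
  have hround : ∀ n < T, (1 - γ) * ∑ j, w n j / (∑ l, w n l) * (η * x n j + (η * x n j) ^ 2) ≤
      η * (p n (ζ n).2 / q n (ζ n).2 * g (n + 1) (ζ n).2 + 3 * β * halfNorm (p n)) := by
    intro n hn
    have h1 : (1 - γ) * ∑ j, w n j / (∑ l, w n l) * (η * x n j + (η * x n j) ^ 2) ≤
        ∑ j, p n j * (η * x n j + (η * x n j) ^ 2) := by
      rw [Finset.mul_sum]
      refine Finset.sum_le_sum fun j _ => ?_
      rw [← mul_assoc]
      refine mul_le_mul_of_nonneg_right (mul_weight_div_le_actionProb n _ j) ?_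
      have := (hx1 n hn j).1
      positivity
    have h2 : ∑ j, p n j * (η * x n j + (η * x n j) ^ 2) =
        η * (∑ j, p n j * x n j + η * ∑ j, p n j * x n j ^ 2) := by
      rw [Finset.mul_sum, ← Finset.sum_add_distrib, Finset.mul_sum]
      exact Finset.sum_congr rfl fun j _ => by ring
    have h3 : ∑ j, p n j * x n j =
        p n (ζ n).2 / q n (ζ n).2 * g (n + 1) (ζ n).2 + β * halfNorm (p n) :=
      sum_mul_estimate (hppos n) _
    have h4 : ∑ j, p n j * x n j ^ 2 ≤ (2 + k * β ^ 2) * halfNorm (p n) :=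
      sum_mul_estimate_sq_le hβ2 (hppos n) (hg n hn) _
    have hβ1 : β ≤ 1 := by nlinarith
    -- The second-order cost is absorbed into the bonus: 2η ≤ β, and ηkβ² ≤ β by ηk ≤ 1 and β ≤ 1.
    have h5 : η * (2 + k * β ^ 2) ≤ 2 * β := by
      have : η * k * β ^ 2 ≤ 1 * (β * 1) := by
        refine mul_le_mul hηk ?_ (sq_nonneg _) zero_le_one
        rw [sq]
        exact mul_le_mul_of_nonneg_left hβ1 hβ.le
      linarith
    have h6 : η * ∑ j, p n j * x n j ^ 2 ≤ 2 * β * halfNorm (p n) := by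
      calc _ ≤ η * ((2 + k * β ^ 2) * halfNorm (p n)) := mul_le_mul_of_nonneg_left h4 hη.le
        _ = η * (2 + k * β ^ 2) * halfNorm (p n) := by ring
        _ ≤ _ := mul_le_mul_of_nonneg_right h5 (halfNorm_nonneg _)
    rw [h2, h3] at h1
    refine h1.trans (mul_le_mul_of_nonneg_left ?_ hη.le)
    linarith
  have hsum : (1 - γ) * ∑ n ∈ Finset.range T,
        ∑ j, w n j / (∑ l, w n l) * (η * x n j + (η * x n j) ^ 2) ≤
      η * ∑ n ∈ Finset.range T,
        (p n (ζ n).2 / q n (ζ n).2 * g (n + 1) (ζ n).2 + 3 * β * halfNorm (p n)) := by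
    rw [Finset.mul_sum, Finset.mul_sum]
    exact Finset.sum_le_sum fun n hn => hround n (Finset.mem_range.mp hn)
  have hlog : 0 ≤ S * Real.log (2 * k * T) + Real.exp 1 := by
    have h1 : (1 : ℝ) ≤ k := by exact_mod_cast hk.le
    have h2 : (1 : ℝ) ≤ T := by exact_mod_cast hT
    have h3 : 0 ≤ Real.log (2 * k * T) := Real.log_nonneg (by nlinarith)
    positivity
  have hmain := mul_le_mul_of_nonneg_left hgain (sub_nonneg.mpr hγ)
  rw [mul_add] at hmain
  have hfirst : (1 - γ) * (S * Real.log (2 * k * T) + Real.exp 1) ≤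
      S * Real.log (2 * k * T) + Real.exp 1 := mul_le_of_le_one_left hlog (by linarith)
  rw [← sub_le_iff_le_add, le_div_iff₀ hη]
  linarith

/-- The underestimation of the reward of `j` by its estimate, scaled by `β`, in the rounds
`a + 1, ..., c`. -/
noncomputable def estimateGap (k T S : ℕ) (μ δ : ℝ) (g : ℕ → Fin k → ℝ) (j : Fin k) (a c n : ℕ)
    (h : Fin n → Fin k × Fin k) (_ b : Fin k) : ℝ :=
  if n ∈ Finset.Ico a c then
    beta k T S μ δ * (g (n + 1) j -
      estimate (beta k T S μ δ) (queryProb k T S μ δ g n h) (g (n + 1)) b j)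
  else 0

/-- The compensated, `l`-scaled deviation of the importance-weighted estimate of the expected reward
of a round. -/
noncomputable def importanceGap (k T S : ℕ) (μ δ : ℝ) (g : ℕ → Fin k → ℝ) (l : ℝ) (n : ℕ)
    (h : Fin n → Fin k × Fin k) (_ b : Fin k) : ℝ :=
  l * (actionProb k T S μ δ g n h b / queryProb k T S μ δ g n h b * g (n + 1) b
      - ∑ j, actionProb k T S μ δ g n h j * g (n + 1) j)
    - l ^ 2 * halfNorm (actionProb k T S μ δ g n h)

/-- The compensated, `l`-scaled deviation of the reward collected in a round from its
expectation. -/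
noncomputable def actionGap (k T S : ℕ) (μ δ : ℝ) (g : ℕ → Fin k → ℝ) (l : ℝ) (n : ℕ)
    (h : Fin n → Fin k × Fin k) (i _ : Fin k) : ℝ :=
  l * (∑ j, actionProb k T S μ δ g n h j * g (n + 1) j - g (n + 1) i) - l ^ 2

theorem law_estimateGap_gt_le (hk : 1 < k) (hβ : 0 ≤ beta k T S μ δ)
    (hγ0 : 0 < gamma k T S μ δ) (hγ : gamma k T S μ δ ≤ 1)
    (hg : ∀ n < T, ∀ i, g (n + 1) i ∈ Set.Icc (0 : ℝ) 1) (j : Fin k) (a c : ℕ) (b : ℝ) :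
    (law hk hγ g T).toMeasure.real {ω | b < pathSum (estimateGap k T S μ δ g j a c) T ω} ≤
      Real.exp (-b) := by
  refine law_pathSum_gt_le hk hγ g _ T (fun n hn h => ?_) b
  have hp1 := sum_actionProb (T := T) (S := S) (μ := μ) (δ := δ) (g := g) hk n h
  have hq1 := sum_queryProb (T := T) (S := S) (μ := μ) (δ := δ) (g := g) hk n h
  have hq : ∀ j, 0 < queryProb k T S μ δ g n h j := sqrtDist_pos (actionProb_pos hγ0 hγ n h)
  simp only [← Finset.sum_mul, estimateGap, hp1, one_mul]
  split_ifs with hac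
  · exact sum_query_exp_estimate_le hβ hq hq1 (hg n hn) j
  · simp [hq1]

theorem law_importanceGap_gt_le (hk : 1 < k)
    (hγ0 : 0 < gamma k T S μ δ) (hγ : gamma k T S μ δ ≤ 1)
    (hg : ∀ n < T, ∀ i, g (n + 1) i ∈ Set.Icc (0 : ℝ) 1) {l : ℝ} (hl : 0 ≤ l) (hlk : l * k ≤ 1)
    (b : ℝ) :
    (law hk hγ g T).toMeasure.real {ω | b < pathSum (importanceGap k T S μ δ g l) T ω} ≤
      Real.exp (-b) := by
  refine law_pathSum_gt_le hk hγ g _ T (fun n hn h => ?_) b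
  have hp1 := sum_actionProb (T := T) (S := S) (μ := μ) (δ := δ) (g := g) hk n h
  simp only [← Finset.sum_mul, importanceGap, hp1, one_mul]
  exact sum_query_exp_importance_le hl hlk (by omega) (actionProb_pos hγ0 hγ n h) hp1 (hg n hn)

theorem law_actionGap_gt_le (hk : 1 < k)
    (hγ0 : 0 < gamma k T S μ δ) (hγ : gamma k T S μ δ ≤ 1)
    (hg : ∀ n < T, ∀ i, g (n + 1) i ∈ Set.Icc (0 : ℝ) 1) {l : ℝ} (hl : 0 ≤ l) (hl1 : l ≤ 1)
    (b : ℝ) :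
    (law hk hγ g T).toMeasure.real {ω | b < pathSum (actionGap k T S μ δ g l) T ω} ≤
      Real.exp (-b) := by
  refine law_pathSum_gt_le hk hγ g _ T (fun n hn h => ?_) b
  have hp1 := sum_actionProb (T := T) (S := S) (μ := μ) (δ := δ) (g := g) hk n h
  have hq1 := sum_queryProb (T := T) (S := S) (μ := μ) (δ := δ) (g := g) hk n h
  simp only [← Finset.sum_mul, actionGap, hq1, one_mul]
  exact sum_action_exp_le hl hl1 (actionProb_pos hγ0 hγ n h) hp1 (hg n hn)

theorem pathSum_restrict (F : (n : ℕ) → (Fin n → Fin k × Fin k) → Fin k → Fin k → ℝ) (n : ℕ)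
    (ζ : ℕ → Fin k × Fin k) :
    pathSum F n (fun i => ζ i) =
      ∑ t ∈ Finset.range n, F t (fun i => ζ i) (ζ t).1 (ζ t).2 := by
  rw [Finset.sum_range]
  rfl

theorem pathSum_estimateGap {a c : ℕ} (hc : c ≤ T) (j : Fin k) (ζ : ℕ → Fin k × Fin k) :
    pathSum (estimateGap k T S μ δ g j a c) T (fun i => ζ i) =
      beta k T S μ δ * (∑ n ∈ Finset.Ico a c, g (n + 1) j - ∑ n ∈ Finset.Ico a c,
        estimate (beta k T S μ δ) (queryProb k T S μ δ g n fun i => ζ i) (g (n + 1)) (ζ n).2 j) := by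
  rw [pathSum_restrict, ← Finset.sum_sub_distrib, Finset.mul_sum]
  simp only [estimateGap]
  rw [← Finset.sum_filter]
  refine Finset.sum_congr ?_ fun _ _ => rfl
  ext n
  simp only [Finset.mem_filter, Finset.mem_range, Finset.mem_Ico]
  omega

theorem segmentation_reward_le (hg : ∀ n < T, ∀ i, g (n + 1) i ∈ Set.Icc (0 : ℝ) 1)
    {τ : Fin (S + 1) → ℕ} (hτ : IsSegmentation T S τ) (a : Fin S → Fin k) :
    ∑ s : Fin S, ∑ n ∈ Finset.Ico (τ s.castSucc) (τ s.succ), g (n + 1) (a s) ≤ T := by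
  obtain ⟨hmono, hτ0, hτT⟩ := hτ
  have hle : ∀ s, τ s ≤ T := fun s => hτT ▸ hmono (Fin.le_last s)
  calc ∑ s : Fin S, ∑ n ∈ Finset.Ico (τ s.castSucc) (τ s.succ), g (n + 1) (a s)
      ≤ ∑ s : Fin S, ((τ s.succ : ℝ) - τ s.castSucc) := by
        refine Finset.sum_le_sum fun s _ => ?_
        calc _ ≤ ∑ n ∈ Finset.Ico (τ s.castSucc) (τ s.succ), (1 : ℝ) := by
              refine Finset.sum_le_sum fun n hn => (hg n ?_ _).2
              exact (Finset.mem_Ico.mp hn).2.trans_le (hle _)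
          _ = _ := by simp [Nat.cast_sub (hmono (Fin.castSucc_le_succ s))]
    _ = T := by rw [sum_succ_sub_castSucc fun s => (τ s : ℝ), hτ0, hτT]; simp

/-- Off the exceptional events, the regret is bounded by explicit terms. -/
theorem regret_le (hk : 1 < k) (hT : 1 ≤ T) (hS : 1 ≤ S) (hμ : 1 ≤ μ)
    (hδ : δ ∈ Set.Ioo (0 : ℝ) 1) (hβ2 : (1 + beta k T S μ δ) ^ 2 ≤ 2)
    (hγ : gamma k T S μ δ ≤ 1)
    (hg : ∀ n < T, ∀ i, g (n + 1) i ∈ Set.Icc (0 : ℝ) 1) {ω : Fin T → Fin k × Fin k}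
    {v l m Λ Γ : ℝ} (hl : 0 < l) (hm : 0 < m)
    (hv : avgHalfNorm k T S μ δ g ω ≤ v) (hΛ0 : 0 ≤ Λ)
    (hΛ : ∀ (j : Fin k) (a c : ℕ), a ≤ T → c ≤ T →
      pathSum (estimateGap k T S μ δ g j a c) T ω ≤ Λ)
    (hl' : pathSum (importanceGap k T S μ δ g l) T ω ≤ Γ)
    (hm' : pathSum (actionGap k T S μ δ g m) T ω ≤ Γ)
    {τ : Fin (S + 1) → ℕ} (hτ : IsSegmentation T S τ) (a : Fin S → Fin k) :
    regret g τ a ω ≤ gamma k T S μ δ * T + S * Λ / beta k T S μ δ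
      + (S * Real.log (2 * k * T) + Real.exp 1) / eta T S μ + 3 * beta k T S μ δ * (T * v)
      + (Γ / l + l * (T * v)) + (Γ / m + m * T) := by
  -- The run is extended to an infinite sequence so that all histories are restrictions of one
  -- function; the default value beyond T is never read.
  obtain ⟨ζ, rfl⟩ : ∃ ζ : ℕ → Fin k × Fin k, ω = fun i : Fin T => ζ i :=
    ⟨fun n => if h : n < T then ω ⟨n, h⟩ else (⟨0, by omega⟩, ⟨0, by omega⟩), by
      funext i; simp⟩
  have hT0 : (0 : ℝ) < T := by exact_mod_cast hT
  have hβ := beta_pos hk hT hS hμ hδ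
  have hγn := gamma_nonneg k T S μ δ
  have hle : ∀ s, τ s ≤ T := fun s => hτ.2.2 ▸ hτ.1 (Fin.le_last s)
  have hgain := estimated_gain_le hk hT hS hμ hδ hβ2 hγ hg ζ hτ a
  have hreward := segmentation_reward_le hg hτ a
  set G := ∑ s : Fin S, ∑ n ∈ Finset.Ico (τ s.castSucc) (τ s.succ), g (n + 1) (a s) with hG
  set X := ∑ s : Fin S, ∑ n ∈ Finset.Ico (τ s.castSucc) (τ s.succ),
        estimate (beta k T S μ δ) (queryProb k T S μ δ g n fun i => ζ i) (g (n + 1)) (ζ n).2 (a s)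
    with hX
  have hGX : G - X ≤ S * Λ / beta k T S μ δ := by
    rw [hG, hX, ← Finset.sum_sub_distrib, mul_div_assoc]
    calc _ ≤ ∑ _s : Fin S, Λ / beta k T S μ δ := by
          refine Finset.sum_le_sum fun s _ => ?_
          have h1 := hΛ (a s) (τ s.castSucc) (τ s.succ) (hle _) (hle _)
          rw [pathSum_estimateGap (hle _)] at h1
          rw [le_div_iff₀ hβ]
          linarith
      _ = _ := by simp
  have hV : ∑ n ∈ Finset.range T, halfNorm (actionProb k T S μ δ g n fun i => ζ i) ≤ T * v := by
    have h1 : avgHalfNorm k T S μ δ g (fun i : Fin T => ζ i) =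
        1 / T * ∑ n ∈ Finset.range T, halfNorm (actionProb k T S μ δ g n fun i => ζ i) := by
      rw [Finset.sum_range]
      rfl
    rw [h1, one_div, inv_mul_le_iff₀ hT0] at hv
    exact hv
  have hreg : regret g τ a (fun i : Fin T => ζ i) =
      G - ∑ n ∈ Finset.range T, g (n + 1) (ζ n).1 := by
    rw [regret, hG, Finset.sum_range]
    congr 1
    refine Finset.sum_congr rfl fun s _ => ?_
    -- Index n stands for round n + 1, which turns the epochs `Ioc` into `Ico`.
    rw [Finset.sum_Ico_add' (fun n => g n (a s))]
    refine Finset.sum_congr ?_ fun _ _ => rfl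
    ext n
    simp only [Finset.mem_Ioc, Finset.mem_Ico]
    omega
  set V := ∑ n ∈ Finset.range T, halfNorm (actionProb k T S μ δ g n fun i => ζ i) with hVdef
  set Y := ∑ n ∈ Finset.range T, actionProb k T S μ δ g n (fun i => ζ i) (ζ n).2 /
            queryProb k T S μ δ g n (fun i => ζ i) (ζ n).2 * g (n + 1) (ζ n).2 with hY
  set M := ∑ n ∈ Finset.range T, ∑ j, actionProb k T S μ δ g n (fun i => ζ i) j * g (n + 1) j
    with hM
  set A := ∑ n ∈ Finset.range T, g (n + 1) (ζ n).1 with hA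
  rw [pathSum_restrict] at hl' hm'
  simp only [importanceGap, Finset.sum_sub_distrib, ← Finset.mul_sum] at hl'
  rw [← hY, ← hM, ← hVdef] at hl'
  simp only [actionGap, Finset.sum_sub_distrib, ← Finset.mul_sum] at hm'
  rw [← hM, ← hA] at hm'
  simp only [Finset.sum_const, Finset.card_range, nsmul_eq_mul] at hm'
  rw [Finset.sum_add_distrib, ← Finset.mul_sum, ← hY, ← hVdef] at hgain
  have h1 : Y - M ≤ Γ / l + l * (T * v) := by
    rw [← sub_le_iff_le_add, le_div_iff₀ hl]
    -- The compensator l²V of the path sum becomes l·T·v after division by l.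
    nlinarith [mul_le_mul_of_nonneg_left hV (sq_nonneg l)]
  have h2 : M - A ≤ Γ / m + m * T := by
    rw [← sub_le_iff_le_add, le_div_iff₀ hm]
    linarith
  have h3 : 3 * beta k T S μ δ * V ≤ 3 * beta k T S μ δ * (T * v) :=
    mul_le_mul_of_nonneg_left hV (by linarith)
  have h4 : gamma k T S μ δ * G ≤ gamma k T S μ δ * T := mul_le_mul_of_nonneg_left hreward hγn
  have h5 : (1 - gamma k T S μ δ) * (G - X) ≤ S * Λ / beta k T S μ δ :=
    (mul_le_mul_of_nonneg_left hGX (by linarith)).trans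
      (mul_le_of_le_one_left (by positivity) (by linarith))
  rw [hreg]
  linarith

end Regret

/-! ### Comparison of the explicit terms with the claimed rate. -/

section FinalBound

variable {k T S : ℕ} {μ δ v : ℝ}

/-- The explicit terms of the regret bound, in terms of the rate of the theorem. -/
theorem explicit_regret_terms_le (hk : 1 < k) (hT : 1 ≤ T) (hS : 1 ≤ S)
    (hμ : μ ∈ Set.Icc (1 : ℝ) k) (hδ : δ ∈ Set.Ioo (0 : ℝ) 1) (hv : 1 ≤ v)
    (hβ2 : (1 + beta k T S μ δ) ^ 2 ≤ 2) :
    gamma k T S μ δ * T + S * Real.log (12 * k * T ^ 2 / δ) / beta k T S μ δ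
      + (S * Real.log (2 * k * T) + Real.exp 1) / eta T S μ + 3 * beta k T S μ δ * (T * v)
      + (Real.log (3 / δ) / (1 / (k + √(T * v))) + 1 / (k + √(T * v)) * (T * v))
      + (Real.log (3 / δ) / (1 / √T) + 1 / √T * T) ≤
    100 * (1 + Real.log (k / δ)) * (1 + Real.log T) *
      (√(S * (v ^ 2 / μ + μ + v) * T) + S * (k : ℝ) ^ 2 / μ) := by
  obtain ⟨hμ1, hμk⟩ := hμ
  have hη := eta_pos hT hS hμ1
  have hηsq := eta_sq (T := T) (S := S) hμ1
  have hηβ : 2 * eta T S μ ≤ beta k T S μ δ := two_mul_eta_le_beta hk hδ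
  have hL1 := one_le_log_three_mul_div hk hδ
  have hδ0 := hδ.1
  have hk2 : (2 : ℝ) ≤ k := by exact_mod_cast hk
  have hT1 : (1 : ℝ) ≤ T := by exact_mod_cast hT
  have hS1 : (1 : ℝ) ≤ S := by exact_mod_cast hS
  have hkδ : 1 ≤ (k : ℝ) / δ := (one_le_div hδ0).mpr (by linarith [hδ.2])
  set η := eta T S μ with hηdef
  set β := beta k T S μ δ with hβdef
  set A := √(S * (v ^ 2 / μ + μ + v) * T) with hA
  set B := S * (k : ℝ) ^ 2 / μ with hB
  have hlogT : 0 ≤ Real.log T := Real.log_nonneg hT1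
  have hlogk : 0 ≤ Real.log (k / δ) := Real.log_nonneg hkδ
  have hlog3 : Real.log 3 ≤ 2 := by
    rw [Real.log_le_iff_le_exp (by norm_num)]; linarith [Real.add_one_le_exp (2 : ℝ)]
  have hlog12 : Real.log 12 ≤ 3 := by
    rw [Real.log_le_iff_le_exp (by norm_num)]
    have h1 : Real.exp 3 = Real.exp 1 ^ 3 := by rw [← Real.exp_nat_mul]; norm_num
    rw [h1]
    have h2 := Real.exp_one_gt_d9
    have h3 : (2.7 : ℝ) ^ 3 ≤ Real.exp 1 ^ 3 := pow_le_pow_left₀ (by norm_num) (by linarith) 3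
    linarith
  set a := Real.log (k / δ) with ha
  set b := Real.log T with hb
  have hL : Real.log (3 * k / δ) ≤ 2 * (1 + a) := by
    rw [mul_div_assoc, Real.log_mul (by norm_num) (by positivity)]
    linarith
  have hΓ : Real.log (3 / δ) ≤ 2 * (1 + a) := by
    refine le_trans (Real.log_le_log (by positivity) ?_) hL
    gcongr
    linarith
  have hΓ0 : 0 ≤ Real.log (3 / δ) :=
    Real.log_nonneg ((one_le_div hδ0).mpr (by linarith [hδ.2]))
  have hΛeq : Real.log (12 * k * T ^ 2 / δ) = Real.log 12 + a + 2 * b := by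
    rw [show 12 * (k : ℝ) * T ^ 2 / δ = 12 * (k / δ) * T ^ 2 by ring,
      Real.log_mul (by positivity) (by positivity), Real.log_mul (by norm_num) (by positivity),
      Real.log_pow]
    push_cast
    ring
  have hΛ : Real.log (12 * k * T ^ 2 / δ) ≤ 3 * ((1 + a) * (1 + b)) := by
    rw [hΛeq]; linarith [mul_nonneg hlogk hlogT]
  have hΛ0 : 0 ≤ Real.log (12 * k * T ^ 2 / δ) := by
    rw [hΛeq]
    have : 0 ≤ Real.log (12 : ℝ) := Real.log_nonneg (by norm_num)
    positivity
  have hlog2 : Real.log (2 * k * T) ≤ 3 * ((1 + a) * (1 + b)) := by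
    refine le_trans (Real.log_le_log (by positivity) ?_) hΛ
    rw [le_div_iff₀ hδ0]
    have h1 : (k : ℝ) * T * 1 ≤ k * T * T := mul_le_mul_of_nonneg_left hT1 (by positivity)
    have h2 : 2 * (k : ℝ) * T * δ ≤ 2 * k * T * 1 :=
      mul_le_mul_of_nonneg_left hδ.2.le (by positivity)
    have h3 : 0 ≤ (k : ℝ) * T * T := by positivity
    linarith
  set P := (1 + a) * (1 + b) with hP
  have hP1 : 1 + a ≤ P := le_mul_of_one_le_right (by linarith) (by linarith)
  have hP0 : 1 ≤ P := by linarith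
  have hA0 : 0 ≤ A := Real.sqrt_nonneg _
  have hvμ : 0 ≤ v ^ 2 / μ := by positivity
  have hsqA : ∀ y : ℝ, 0 ≤ y → y ^ 2 ≤ S * (v ^ 2 / μ + μ + v) * T → y ≤ A :=
    fun y hy h => Real.le_sqrt_of_sq_le h
  have hSη : S / η ≤ A := by
    refine hsqA _ (by positivity) ?_
    rw [div_pow, hηsq]
    have : (S : ℝ) ^ 2 / (S / (μ * T)) = S * μ * T := by field_simp
    rw [this]
    gcongr
    linarith
  have hηTv : η * (T * v) ≤ A := by
    refine hsqA _ (by positivity) ?_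
    have : (η * (T * v)) ^ 2 = S * (v ^ 2 / μ) * T := by
      rw [mul_pow, hηsq]; field_simp
    rw [this]
    gcongr
    linarith
  have hTv : √(T * v) ≤ A := by
    refine Real.sqrt_le_sqrt ?_
    have h1 : v ≤ v ^ 2 / μ + μ + v := by linarith
    have h2 : 1 * (T * v) ≤ S * (T * v) := mul_le_mul_of_nonneg_right hS1 (by positivity)
    have h3 : (S : ℝ) * T * v ≤ S * T * (v ^ 2 / μ + μ + v) :=
      mul_le_mul_of_nonneg_left h1 (by positivity)
    linarith
  have hTA : √T ≤ A := by
    refine le_trans (Real.sqrt_le_sqrt ?_) hTv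
    exact le_mul_of_one_le_right (by linarith) hv
  -- Here μ ≤ k enters; it absorbs the summand k of 1/l.
  have hkB : k ≤ B := by
    rw [hB, le_div_iff₀ (by linarith)]
    have h1 : (k : ℝ) * μ ≤ k * k := mul_le_mul_of_nonneg_left hμk (by linarith)
    have h2 : 1 * (k : ℝ) ^ 2 ≤ S * k ^ 2 := mul_le_mul_of_nonneg_right hS1 (sq_nonneg _)
    linarith
  have hB0 : 0 ≤ B := by linarith
  have t1 : gamma k T S μ δ * T ≤ 2 * B := by
    have h1 : gamma k T S μ δ * T = B * (1 + β) ^ 2 := by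
      rw [gamma, ← hηdef, hηsq, ← hβdef, hB]; field_simp
    rw [h1, mul_comm 2]
    exact mul_le_mul_of_nonneg_left hβ2 hB0
  have t2 : S * Real.log (12 * k * T ^ 2 / δ) / β ≤ 3 * P * A := by
    calc S * Real.log (12 * k * T ^ 2 / δ) / β
        ≤ S * Real.log (12 * k * T ^ 2 / δ) / η := by
          gcongr; linarith
      _ = Real.log (12 * k * T ^ 2 / δ) * (S / η) := by ring
      _ ≤ 3 * P * A := mul_le_mul hΛ hSη (by positivity) (by positivity)
  have t3 : (S * Real.log (2 * k * T) + Real.exp 1) / η ≤ 6 * P * A := by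
    have h1 : S * Real.log (2 * k * T) + Real.exp 1 ≤ S * (6 * P) := by
      have h2 : S * Real.log (2 * k * T) ≤ S * (3 * P) :=
        mul_le_mul_of_nonneg_left hlog2 (by linarith)
      have h3 : Real.exp 1 ≤ 3 := by linarith [Real.exp_one_lt_d9]
      have h4 : 1 * 1 ≤ (S : ℝ) * P := mul_le_mul hS1 hP0 zero_le_one (by linarith)
      linarith
    calc _ ≤ S * (6 * P) / η := by gcongr
      _ = 6 * P * (S / η) := by ring
      _ ≤ _ := mul_le_mul_of_nonneg_left hSη (by linarith)
  have t4 : 3 * β * (T * v) ≤ 72 * P * A := by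
    -- The crude √z ≤ z for z ≥ 1 suffices and keeps the exponent of 1 + log(k/δ) equal to 1.
    have h1 : √(6 * Real.log (3 * k / δ)) ≤ 12 * P := by
      have h2 : √(6 * Real.log (3 * k / δ)) ≤ 6 * Real.log (3 * k / δ) := by
        rw [Real.sqrt_le_left (by linarith)]
        exact le_self_pow₀ (by linarith) two_ne_zero
      linarith
    calc 3 * β * (T * v) = 6 * √(6 * Real.log (3 * k / δ)) * (η * (T * v)) := by
          rw [hβdef, beta]; ring
      _ ≤ 6 * (12 * P) * A := mul_le_mul (by linarith) hηTv (by positivity) (by linarith)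
      _ = _ := by ring
  have t5 : Real.log (3 / δ) / (1 / (k + √(T * v))) ≤ 2 * P * (B + A) := by
    rw [div_div_eq_mul_div, div_one]
    exact mul_le_mul (by linarith) (by linarith) (by positivity) (by linarith)
  have t6 : 1 / (k + √(T * v)) * (T * v) ≤ A := by
    refine le_trans ?_ hTv
    rw [one_div_mul_eq_div, div_le_iff₀ (by positivity)]
    linarith [Real.mul_self_sqrt (by positivity : (0 : ℝ) ≤ T * v),
      mul_nonneg (Real.sqrt_nonneg (T * v)) (Nat.cast_nonneg k)]
  have t7 : Real.log (3 / δ) / (1 / √T) ≤ 2 * P * A := by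
    rw [div_div_eq_mul_div, div_one]
    exact mul_le_mul (by linarith) hTA (by positivity) (by linarith)
  have t8 : 1 / √T * T ≤ A := by
    rw [one_div_mul_eq_div, Real.div_sqrt]
    exact hTA
  have hPA : A ≤ P * A := le_mul_of_one_le_left hA0 hP0
  have hPB : B ≤ P * B := le_mul_of_one_le_left hB0 hP0
  rw [mul_assoc 100, ← hP]
  -- The coefficients add up to 87 for P·A and 4 for P·B, below 100.
  linarith

end FinalBound

end SwitchingBandit

/-! ### Union bound and conclusion. -/

theorem theorem3 :
    ∃ (C : ℝ) (c : ℕ), 0 < C ∧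
      ∀ (k T S : ℕ) (μ δ v : ℝ) (g : ℕ → Fin k → ℝ)
        (hk : 1 < k) (_ : 1 ≤ T) (_ : 1 ≤ S)
        (_ : μ ∈ Set.Icc (1 : ℝ) k) (_ : δ ∈ Set.Ioo (0 : ℝ) 1) (_ : v ∈ Set.Icc (1 : ℝ) k)
        (_ : ∀ t ∈ Finset.Icc 1 T, ∀ i, g t i ∈ Set.Icc (0 : ℝ) 1)
        (_ : (1 + SwitchingBandit.beta k T S μ δ) ^ 2 ≤ 2)
        (hγ : SwitchingBandit.gamma k T S μ δ ≤ 1),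
        1 - δ - SwitchingBandit.excessProb hk hγ g v ≤
          (SwitchingBandit.law hk hγ g T).toMeasure.real
            {ω | ∀ (τ : Fin (S + 1) → ℕ) (a : Fin S → Fin k),
              SwitchingBandit.IsSegmentation T S τ →
              SwitchingBandit.regret g τ a ω ≤
                C * (1 + Real.log (k / δ)) ^ c * (1 + Real.log T) *
                  (√(S * (v ^ 2 / μ + μ + v) * T) + S * (k : ℝ) ^ 2 / μ
                    + (k : ℝ) ^ 2 / (T : ℝ) ^ (3 / 2 : ℝ))} := by
  refine ⟨100, 1, by norm_num, ?_⟩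
  intro k T S μ δ v g hk hT hS hμ hδ hv hgIcc hβ2 hγ
  have hg : ∀ n < T, ∀ i, g (n + 1) i ∈ Set.Icc (0 : ℝ) 1 := fun n hn =>
    hgIcc (n + 1) (Finset.mem_Icc.mpr ⟨by omega, by omega⟩)
  have hδ0 := hδ.1
  have hk2 : (2 : ℝ) ≤ k := by exact_mod_cast hk
  have hT1 : (1 : ℝ) ≤ T := by exact_mod_cast hT
  have hv0 : 0 < v := by linarith [hv.1]
  have hη := SwitchingBandit.eta_pos hT hS hμ.1
  have hβ := SwitchingBandit.beta_pos hk hT hS hμ.1 hδ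
  have hγ0 := SwitchingBandit.gamma_pos hk hη hβ.le
  set P := (SwitchingBandit.law hk hγ g T).toMeasure with hP
  -- This balances Γ/l against l·T·v at order √(Tv); the summand k enforces l * k ≤ 1.
  set l : ℝ := 1 / (k + √(T * v)) with hl
  set m : ℝ := 1 / √T with hm
  -- There are k(T + 1)² ≤ 4kT² triples of an action and two endpoints, so failure probability
  -- δ/(12kT²) for each totals at most δ/3.
  set Λ : ℝ := Real.log (12 * k * T ^ 2 / δ) with hΛ
  set Γ : ℝ := Real.log (3 / δ) with hΓ
  have hl0 : 0 < l := by positivity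
  have hm0 : 0 < m := by positivity
  have hlk : l * k ≤ 1 := by
    rw [hl, one_div_mul_eq_div, div_le_one (by positivity)]
    linarith [Real.sqrt_nonneg (T * v)]
  have hm1 : m ≤ 1 := by
    rw [hm, div_le_one (by positivity)]
    exact Real.one_le_sqrt.mpr hT1
  have hΛ0 : 0 ≤ Λ := by
    refine Real.log_nonneg ((one_le_div hδ0).mpr ?_)
    nlinarith [hδ.2, one_le_pow₀ (n := 2) hT1]
  have hexpΛ : Real.exp (-Λ) = δ / (12 * k * T ^ 2) := by
    rw [Real.exp_neg, hΛ, Real.exp_log (by positivity), inv_div]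
  have hexpΓ : Real.exp (-Γ) = δ / 3 := by
    rw [Real.exp_neg, hΓ, Real.exp_log (by positivity), inv_div]
  set E₁ : Fin k × Fin (T + 1) × Fin (T + 1) → Set (Fin T → Fin k × Fin k) := fun y =>
    {ω | Λ < SwitchingBandit.pathSum
      (SwitchingBandit.estimateGap k T S μ δ g y.1 y.2.1 y.2.2) T ω} with hE₁
  set E₂ : Set (Fin T → Fin k × Fin k) :=
    {ω | Γ < SwitchingBandit.pathSum (SwitchingBandit.importanceGap k T S μ δ g l) T ω} with hE₂
  set E₃ : Set (Fin T → Fin k × Fin k) :=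
    {ω | Γ < SwitchingBandit.pathSum (SwitchingBandit.actionGap k T S μ δ g m) T ω} with hE₃
  set E₄ : Set (Fin T → Fin k × Fin k) :=
    {ω | v < SwitchingBandit.avgHalfNorm k T S μ δ g ω} with hE₄
  have h1 : P.real (⋃ y, E₁ y) ≤ δ / 3 := by
    refine (MeasureTheory.measureReal_iUnion_fintype_le E₁).trans ?_
    calc ∑ y, P.real (E₁ y) ≤ ∑ _y : Fin k × Fin (T + 1) × Fin (T + 1), δ / (12 * k * T ^ 2) :=
          Finset.sum_le_sum fun y _ => hexpΛ ▸
            SwitchingBandit.law_estimateGap_gt_le hk hβ.le hγ0 hγ hg y.1 y.2.1 y.2.2 Λ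
      _ = δ / 3 * ((T + 1) / (2 * T)) ^ 2 := by
          simp only [Finset.sum_const, Finset.card_univ, Fintype.card_prod, Fintype.card_fin,
            nsmul_eq_mul]
          push_cast
          field_simp
          ring
      _ ≤ δ / 3 * 1 := by
          refine mul_le_mul_of_nonneg_left (pow_le_one₀ (by positivity) ?_) (by positivity)
          rw [div_le_one (by positivity)]
          linarith
      _ = δ / 3 := mul_one _
  have h2 : P.real E₂ ≤ δ / 3 := hexpΓ ▸
    SwitchingBandit.law_importanceGap_gt_le hk hγ0 hγ hg hl0.le hlk Γ
  have h3 : P.real E₃ ≤ δ / 3 := hexpΓ ▸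
    SwitchingBandit.law_actionGap_gt_le hk hγ0 hγ hg hm0.le hm1 Γ
  have h4 : SwitchingBandit.excessProb hk hγ g v = P.real E₄ := rfl
  rw [h4]
  set R : Set (Fin T → Fin k × Fin k) := {ω | _} with hR
  have hcover : Set.univ ⊆ R ∪ ((⋃ y, E₁ y) ∪ (E₂ ∪ (E₃ ∪ E₄))) := by
    intro ω _
    by_contra hω
    simp only [Set.mem_union, Set.mem_iUnion, not_or, not_exists] at hω
    obtain ⟨hωR, hω1, hω2, hω3, hω4⟩ := hω
    refine hωR fun τ a hτ => ?_
    refine (SwitchingBandit.regret_le hk hT hS hμ.1 hδ hβ2 hγ hg hl0 hm0 (not_lt.mp hω4) hΛ0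
      (fun j a c ha hc => not_lt.mp (hω1 ⟨j, ⟨a, by omega⟩, ⟨c, by omega⟩⟩))
      (not_lt.mp hω2) (not_lt.mp hω3) hτ a).trans ?_
    refine (SwitchingBandit.explicit_regret_terms_le hk hT hS hμ hδ hv.1 hβ2).trans ?_
    rw [pow_one]
    have hlogT : 0 ≤ Real.log T := Real.log_nonneg hT1
    have hlogk : 0 ≤ Real.log (k / δ) :=
      Real.log_nonneg ((one_le_div hδ0).mpr (by linarith [hδ.2]))
    refine mul_le_mul_of_nonneg_left ?_ (by positivity)
    -- The bound already holds without this term, which only needs to be nonnegative.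
    have : 0 ≤ (k : ℝ) ^ 2 / (T : ℝ) ^ (3 / 2 : ℝ) := by positivity
    linarith
  have huniv : P.real Set.univ = 1 := MeasureTheory.probReal_univ
  have h5 := MeasureTheory.measureReal_mono (μ := P) hcover
  have h6 := MeasureTheory.measureReal_union_le (μ := P) R ((⋃ y, E₁ y) ∪ (E₂ ∪ (E₃ ∪ E₄)))
  have h7 := MeasureTheory.measureReal_union_le (μ := P) (⋃ y, E₁ y) (E₂ ∪ (E₃ ∪ E₄))
  have h8 := MeasureTheory.measureReal_union_le (μ := P) E₂ (E₃ ∪ E₄)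
  have h9 := MeasureTheory.measureReal_union_le (μ := P) E₃ E₄
  linarith
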